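/- Let $s\ge 1$. Let $P_1,\dots,P_s$ be the shifted Legendre polynomials on $[0,1]$, $\deg P_j=j-1$, with positive leading coefficients and normalized by $\int_0^1P_iP_j\,d\tau=\delta_{ij}$; let $c_1<\dots<c_s$ and $b_1,\dots,b_s$ be the abscissae and weights of the $s$-point Gauss--Legendre quadrature formula on $[0,1]$, and let $\mathcal P=(P_j(c_i))_{i,j=1}^s$. Let $X_s$ be the tridiagonal $s\times s$ matrix with diagonal $(\tfrac12,0,\dots,0)$, subdiagonal $(\xi_1,\dots,\xi_{s-1})$ and superdiagonal $(-\xi_1,\dots,-\xi_{s-1})$, where $\xi_j=\frac{1}{2\sqrt{(2j+1)(2j-1)}}$, and let $W_s$ be the $s\times s$ matrix whose only nonzero entries are $(W_s)_{s,s-1}=1$ and $(W_s)_{s-1,s}=-1$ (so $W_1=0$). For $\alpha\in\mathbb R$ put $\mathcal A(\alpha)=(a_{ij}(\alpha))=\mathcal P\,(X_s+\alpha W_s)\,\mathcal P^{-1}$, and consider the Runge--Kutta method with Butcher matrix $\mathcal A(\alpha)$ and weights $b_i$ (for $\alpha=0$ this is the $s$-stage Gauss method). Let $\alpha:\mathbb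 R\to\mathbb R$ be a function of the stepsize with $\alpha(h)=O(h^2)$ as $h\to0$. Then the one-step method which with stepsize $h$ uses the parameter $\alpha(h)$ has order $2s$, that is: let $U\subseteq\mathbb R^n$ be open, $f:U\to\mathbb R^n$ of class $C^{2s}$ (for instance $f=J\nabla H$ for a Hamiltonian $H$ of class $C^{2s+1}$), $y_0\in U$, and let $y$ be a solution of $\dot y=f(y)$, $y(t_0)=y_0$, near $t_0$. Then there are $r>0$ with $\{x:\|x-y_0\|\le r\}\subseteq U$, $h_0>0$ and $C$ such that for every $h$ with $|h|\le h_0$ the system $$Y_i=y_0+h\sum_{j=1}^s a_{ij}(\alpha(h))\,f(Y_j),\qquad i=1,\dots,s,$$ has exactly one solution with $\|Y_i-y_0\|\le r$ for all $i$, and $y_1=y_0+h\sum_{i=1}^s b_i f(Y_i)$ satisfies $$\|y_1-y(t_0+h)\|\le C\,|h|^{2s+1}.$$ -/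

import Mathlib

open Filter Topology Asymptotics

noncomputable section

namespace QGauss

/-- The `j`-th orthonormal shifted Legendre polynomial on `[0,1]` (degree `j`, positive leading
coefficient): `∫₀¹ Pᵢ Pⱼ = δᵢⱼ`. Mathlib's `Polynomial.shiftedLegendre j` has leading coefficient of
sign `(-1)^j` and squared `L²(0,1)` norm `1/(2j+1)`, hence the factor. -/
def legendre (j : ℕ) : Polynomial ℝ :=
  Polynomial.C ((-1) ^ j * √(2 * j + 1)) *
    (Polynomial.shiftedLegendre j).map (Int.castRingHom ℝ)

/-- The Gauss-Legendre abscissae `c₀ < ⋯ < c_{s-1}` on `[0,1]`: the zeros of the Legendre polynomial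
of degree `s`, in increasing order. (There are exactly `s` of them, so the default value of `getD`
is never used.) -/
def node (s : ℕ) (i : Fin s) : ℝ :=
  ((legendre s).roots.sort (· ≤ ·)).getD i 0

/-- The Gauss-Legendre weights `bᵢ = ∫₀¹ ℓᵢ(τ) dτ`, with `ℓᵢ` the Lagrange basis at the nodes. -/
def weight (s : ℕ) (i : Fin s) : ℝ :=
  ∫ τ in (0 : ℝ)..1, (Lagrange.basis Finset.univ (node s) i).eval τ

/-- The matrix `𝒫` with entries `Pⱼ(cᵢ)`. -/
def legendreMatrix (s : ℕ) : Matrix (Fin s) (Fin s) ℝ :=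
  Matrix.of fun i j => (legendre j).eval (node s i)

/-- `ξⱼ = 1 / (2 √((2j+1)(2j-1)))`, used for `j ≥ 1` only. -/
def xi (j : ℕ) : ℝ :=
  1 / (2 * √((2 * j + 1) * (2 * j - 1)))

/-- The matrix `X_s`: tridiagonal, with diagonal `(1/2, 0, …, 0)`, subdiagonal `(ξ₁, …, ξ_{s-1})` and
superdiagonal `(-ξ₁, …, -ξ_{s-1})`. -/
def xMatrix (s : ℕ) : Matrix (Fin s) (Fin s) ℝ :=
  Matrix.of fun i j =>
    if (i : ℕ) = 0 ∧ (j : ℕ) = 0 then 1 / 2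
    else if (i : ℕ) = j + 1 then xi i
    else if (j : ℕ) = i + 1 then -xi j
    else 0

/-- The matrix `W_s`: its only nonzero entries are `1` in the last place of the subdiagonal and `-1`
in the last place of the superdiagonal. -/
def wMatrix (s : ℕ) : Matrix (Fin s) (Fin s) ℝ :=
  Matrix.of fun i j =>
    if (i : ℕ) = j + 1 ∧ (i : ℕ) + 1 = s then 1
    else if (j : ℕ) = i + 1 ∧ (j : ℕ) + 1 = s then -1
    else 0

/-- The Butcher matrix `𝒜(α) = 𝒫 (X_s + α W_s) 𝒫⁻¹` of the parametric method. -/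
def butcher (s : ℕ) (α : ℝ) : Matrix (Fin s) (Fin s) ℝ :=
  legendreMatrix s * (xMatrix s + α • wMatrix s) * (legendreMatrix s)⁻¹

section RungeKutta

variable {s : ℕ} {E : Type*} [NormedAddCommGroup E] [NormedSpace ℝ E]

/-- `Y₁, …, Y_s` solve the stage equations `Yᵢ = y₀ + h ∑ⱼ aᵢⱼ f(Yⱼ)`. -/
def IsStages (A : Matrix (Fin s) (Fin s) ℝ) (f : E → E) (h : ℝ) (y₀ : E) (Y : Fin s → E) : Prop :=
  ∀ i, Y i = y₀ + h • ∑ j, A i j • f (Y j)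

/-- The new approximation `y₁ = y₀ + h ∑ᵢ bᵢ f(Yᵢ)`. -/
def step (b : Fin s → ℝ) (f : E → E) (h : ℝ) (y₀ : E) (Y : Fin s → E) : E :=
  y₀ + h • ∑ i, b i • f (Y i)

end RungeKutta

/-- The one-step method that, with stepsize `h`, performs a Runge-Kutta step with Butcher matrix
`A h` and weights `b`, has order `p` (for autonomous systems): for every open `U ⊆ ℝⁿ`, every vector
field `f` of class `C^p` on `U`, every `y₀ ∈ U` and every local solution `y` of `y' = f(y)`,
`y(t₀) = y₀`, the stage equations have, for all `h` close to `0`, exactly one solution near `y₀`, and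
the resulting `y₁` satisfies `‖y₁ - y(t₀ + h)‖ ≤ C |h|^(p+1)`. -/
def HasOrder {s : ℕ} (A : ℝ → Matrix (Fin s) (Fin s) ℝ) (b : Fin s → ℝ) (p : ℕ) : Prop :=
  ∀ (n : ℕ) (U : Set (EuclideanSpace ℝ (Fin n)))
    (f : EuclideanSpace ℝ (Fin n) → EuclideanSpace ℝ (Fin n))
    (y₀ : EuclideanSpace ℝ (Fin n)) (t₀ : ℝ) (y : ℝ → EuclideanSpace ℝ (Fin n)),
    IsOpen U → ContDiffOn ℝ p f U → y₀ ∈ U →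
    y t₀ = y₀ → (∀ᶠ t in 𝓝 t₀, HasDerivAt y (f (y t)) t) →
    ∃ r > 0, Metric.closedBall y₀ r ⊆ U ∧ ∃ h₀ > 0, ∃ C : ℝ, ∀ h : ℝ, |h| ≤ h₀ →
      (∃! Y : Fin s → EuclideanSpace ℝ (Fin n),
        (∀ i, Y i ∈ Metric.closedBall y₀ r) ∧ IsStages (A h) f h y₀ Y) ∧
      ∀ Y : Fin s → EuclideanSpace ℝ (Fin n),
        (∀ i, Y i ∈ Metric.closedBall y₀ r) → IsStages (A h) f h y₀ Y →
          ‖step b f h y₀ Y - y (t₀ + h)‖ ≤ C * |h| ^ (p + 1)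

end QGauss

end

noncomputable section

namespace QGauss

open Polynomial

/-! The Gauss method satisfies Butcher's simplifying assumptions B(2s), C(s), D(s)
(`gauss_weight_moment`, `gauss_stage_moment`, `gauss_adjoint_moment`). They follow from
orthogonality: s-point quadrature is exact below degree 2s, and X_s expresses integration from 0 in
the Legendre basis, where its missing P_s term vanishes at the nodes.

The perturbation B = 𝒫 W_s 𝒫⁻¹ couples only the two highest Legendre modes. Hence it annihilates
monomials of degree below s-2 from either side, and as a bilinear form it kills t^k ⊗ t^l whenever
k+l < 2s-3 (`perturbation_right`, `perturbation_left`, `perturbation_bilinear`). Its coefficient in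
the stage equations is β = hα(h) = O(h^3), so the stages keep the error O(h^(s+1))
(`stage_error_isBigO`).

The superconvergent order comes from a duality argument instead of order trees (`perturbed_order`).
With J = f'(y(t)), take a polynomial M of degree at most s-1 with M(0) = 1 and M' + MJ = O(t^(s-1)).
D(s) is a discrete integration by parts against such M, and the exact integration by parts is
reproduced by quadrature up to O(h^(2s+1)). Thus M(h)(y₁ - y(h)) reduces to three sums, each
carrying an outer factor h: the quadratic Taylor remainder of f, of size (h^(s+1))²; the adjoint
defect times the stage error, h^(s-1)·h^(s+1); and the perturbation, h^3·h^(2s-3). All are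
O(h^(2s+1)), and M(h) is close to the identity. -/

/-! ### Polynomial integrals over the unit interval. -/

/-- The shifted Legendre polynomial with real coefficients. -/
def slReal (n : ℕ) : ℝ[X] := (shiftedLegendre n).map (Int.castRingHom ℝ)

/-- The integral of a polynomial over `[0,1]`. -/
def unitIntegral (p : ℝ[X]) : ℝ := ∫ τ in (0 : ℝ)..1, p.eval τ

lemma polyIntegrable (p : ℝ[X]) (a b : ℝ) :
    IntervalIntegrable (fun τ => p.eval τ) MeasureTheory.volume a b :=
  p.continuous.intervalIntegrable _ _

lemma unitIntegral_add (p q : ℝ[X]) :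
    unitIntegral (p + q) = unitIntegral p + unitIntegral q := by
  simp only [unitIntegral, eval_add]
  exact intervalIntegral.integral_add (polyIntegrable p _ _) (polyIntegrable q _ _)

lemma unitIntegral_C_mul (a : ℝ) (p : ℝ[X]) : unitIntegral (C a * p) = a * unitIntegral p := by
  simp [unitIntegral]

@[simp] lemma unitIntegral_zero : unitIntegral 0 = 0 := by simp [unitIntegral]

lemma unitIntegral_sub (p q : ℝ[X]) :
    unitIntegral (p - q) = unitIntegral p - unitIntegral q := by
  simp only [unitIntegral, eval_sub]
  exact intervalIntegral.integral_sub (polyIntegrable p _ _) (polyIntegrable q _ _)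

lemma unitIntegral_sum {ι : Type*} (t : Finset ι) (p : ι → ℝ[X]) :
    unitIntegral (∑ i ∈ t, p i) = ∑ i ∈ t, unitIntegral (p i) := by
  classical
  induction t using Finset.induction_on with
  | empty => simp
  | insert a t ha ih => rw [Finset.sum_insert ha, Finset.sum_insert ha, unitIntegral_add, ih]

lemma unitIntegral_derivative (p : ℝ[X]) :
    unitIntegral (derivative p) = p.eval 1 - p.eval 0 :=
  intervalIntegral.integral_eq_sub_of_hasDerivAt (fun x _ => p.hasDerivAt x)
    (polyIntegrable _ _ _)

lemma unitIntegral_derivative_mul (p q : ℝ[X]) :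
    unitIntegral (derivative p * q) =
      p.eval 1 * q.eval 1 - p.eval 0 * q.eval 0 - unitIntegral (p * derivative q) := by
  have h := unitIntegral_derivative (p * q)
  rw [derivative_mul, unitIntegral_add, eval_mul, eval_mul] at h
  linarith

lemma unitIntegral_pos {p : ℝ[X]} (hp : p ≠ 0) (h : ∀ x, 0 ≤ p.eval x) : 0 < unitIntegral p := by
  refine lt_of_le_of_ne (intervalIntegral.integral_nonneg zero_le_one fun x _ => h x) fun h0 => hp ?_
  have hz : ∀ x ∈ Set.Ioo (0 : ℝ) 1, p.eval x = 0 := by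
    intro x hx
    by_contra hne
    have : 0 < unitIntegral p :=
      intervalIntegral.integral_pos zero_lt_one p.continuous.continuousOn (fun x _ => h x)
        ⟨x, Set.Ioo_subset_Icc_self hx, lt_of_le_of_ne (h x) (Ne.symm hne)⟩
    exact absurd h0 this.ne
  exact p.eq_zero_of_infinite_isRoot ((Set.Ioo_infinite zero_lt_one).mono hz)

/-! ### Shifted Legendre polynomials: derivative recurrence, orthogonality, norms. -/

/-- In this form n enters through a single binomial, so a recurrence in n becomes a statement about
Pascal's triangle. -/
lemma slReal_coeff (n k : ℕ) :
    (slReal n).coeff k = (-1) ^ k * ((n + k).choose (2 * k) * (k.centralBinom) : ℕ) := by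
  rw [slReal, coeff_map, coeff_shiftedLegendre]
  have : (n + k).choose (2 * k) * k.centralBinom = n.choose k * (n + k).choose n := by
    rcases lt_or_ge n k with h | h
    · rw [Nat.choose_eq_zero_of_lt (by omega), Nat.choose_eq_zero_of_lt h]; simp
    · rw [Nat.centralBinom, Nat.choose_mul (by omega), mul_comm,
        show n + k - k = n by omega, show 2 * k - k = k by omega, Nat.choose_symm_add]
  rw [this]
  push_cast
  simp [mul_assoc]

lemma slReal_degree (n : ℕ) : (slReal n).degree = n := by
  rw [slReal, degree_map_eq_of_injective (RingHom.injective_int _), degree_shiftedLegendre]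

lemma slReal_zero : slReal 0 = 1 := by
  simp [slReal, shiftedLegendre]

lemma slReal_eval_zero (n : ℕ) : (slReal n).eval 0 = 1 := by
  rw [← coeff_zero_eq_eval_zero, slReal_coeff]; simp

lemma slReal_eval_one (n : ℕ) : (slReal n).eval 1 = (-1) ^ n := by
  have h := shiftedLegendre_eval_symm n (1 : ℝ)
  have h0 := slReal_eval_zero n
  rw [slReal, eval_map] at h0 ⊢
  simp only [aeval_def, sub_self] at h
  change eval₂ (Int.castRingHom ℝ) _ _ = _ * eval₂ (Int.castRingHom ℝ) _ _ at h
  rw [h, h0, mul_one]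

/-- Pascal's rule applied twice leaves `N.choose m + 2 * N.choose (m + 1)`. With N = n+k+1 and m =
2k this is the coefficientwise content of `slReal_derivative_sub`. -/
lemma choose_add_two_sub (N m : ℕ) :
    ((m : ℝ) + 1) * ((N + 2).choose (m + 2) - N.choose (m + 2)) = (2 * N - m + 1) * N.choose m := by
  have h := Nat.choose_succ_right_eq N m
  rw [Nat.choose_succ_succ' (N + 1) (m + 1), Nat.choose_succ_succ' N m,
    Nat.choose_succ_succ' N (m + 1)]
  rcases lt_or_ge N m with hN | hN
  · simp [Nat.choose_eq_zero_of_lt hN, Nat.choose_eq_zero_of_lt (show N < m + 1 by omega)]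
  · have h' : (N.choose (m + 1) : ℝ) * (m + 1) = N.choose m * (N - m) := by
      rw [← Nat.cast_sub hN]; exact_mod_cast h
    push_cast
    linear_combination 2 * h'

lemma slReal_derivative_sub (n : ℕ) :
    derivative (slReal (n + 2) - slReal n) = C (-2 * (2 * n + 3) : ℝ) * slReal (n + 1) := by
  ext k
  rw [coeff_derivative, coeff_sub, coeff_C_mul, slReal_coeff, slReal_coeff, slReal_coeff]
  have h1 : ((k : ℝ) + 1) * (k + 1).centralBinom = 2 * (2 * k + 1) * k.centralBinom := by
    exact_mod_cast Nat.succ_mul_centralBinom_succ k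
  have h2 := choose_add_two_sub (n + k + 1) (2 * k)
  rw [show n + 2 + (k + 1) = n + k + 1 + 2 by ring, show n + (k + 1) = n + k + 1 by ring,
    show n + 1 + k = n + k + 1 by ring, show 2 * (k + 1) = 2 * k + 2 by ring, pow_succ]
  push_cast at h2 ⊢
  linear_combination (-(-1 : ℝ) ^ k * (((n + k + 1 + 2).choose (2 * k + 2) : ℝ) -
    (n + k + 1).choose (2 * k + 2))) * h1 - 2 * (-1 : ℝ) ^ k * k.centralBinom * h2

lemma slReal_boundary (n : ℕ) :
    (slReal (n + 2) - slReal n).eval 1 = 0 ∧ (slReal (n + 2) - slReal n).eval 0 = 0 := by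
  simp [slReal_eval_one, slReal_eval_zero, pow_add]

/-- Integration by parts without boundary terms. It trades q for its derivative, which drives the
induction for orthogonality. -/
lemma slReal_mul_parts (n : ℕ) (q : ℝ[X]) :
    (2 * (2 * n + 3) : ℝ) * unitIntegral (slReal (n + 1) * q) =
      unitIntegral (slReal (n + 2) * derivative q) - unitIntegral (slReal n * derivative q) := by
  have h := unitIntegral_derivative_mul (slReal (n + 2) - slReal n) q
  rw [slReal_derivative_sub, mul_assoc, unitIntegral_C_mul, (slReal_boundary n).1,
    (slReal_boundary n).2, sub_mul, unitIntegral_sub] at h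
  linarith

lemma slReal_orthogonal_aux (d : ℕ) : ∀ (n : ℕ) (q : ℝ[X]), q.degree < d → d ≤ n →
    unitIntegral (slReal n * q) = 0 := by
  induction d with
  | zero =>
    intro n q hq _
    have : q = 0 := by
      rw [← degree_eq_bot]; exact Nat.WithBot.lt_zero_iff.1 (by simpa using hq)
    simp [this]
  | succ d ih =>
    intro n q hq hn
    obtain ⟨m, rfl⟩ : ∃ m, n = m + 1 := ⟨n - 1, by omega⟩
    have hq' : (derivative q).degree < d := by
      by_cases h0 : q = 0
      · simp [h0]
      · have h1 := degree_derivative_lt h0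
        have h2 : q.degree ≤ d := Order.lt_succ_iff.1 (by exact_mod_cast hq)
        exact h1.trans_le h2
    have h := slReal_mul_parts m q
    rw [ih _ _ hq' (by omega), ih _ _ hq' (by omega), sub_zero] at h
    have : (2 * (2 * m + 3) : ℝ) ≠ 0 := by positivity
    exact (mul_eq_zero.1 h).resolve_left this

lemma slReal_orthogonal {n : ℕ} {q : ℝ[X]} (hq : q.degree < n) :
    unitIntegral (slReal n * q) = 0 :=
  slReal_orthogonal_aux n n q hq le_rfl

lemma slReal_norm (n : ℕ) : unitIntegral (slReal n * slReal n) = 1 / (2 * n + 1) := by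
  rcases n with _ | m
  · simp [slReal_zero, unitIntegral]
  · have hne : ∀ k, slReal k ≠ 0 := fun k h => by simpa [h] using slReal_degree k
    -- Two integrations by parts leave only boundary values, since every other integral pairs a
    -- Legendre polynomial with one of lower degree.
    have h1 := slReal_mul_parts m (slReal (m + 1))
    have h2 := unitIntegral_derivative_mul (slReal (m + 1)) (slReal m)
    have h3 : unitIntegral (slReal (m + 2) * derivative (slReal (m + 1))) = 0 := by
      apply slReal_orthogonal
      refine (degree_derivative_lt (hne _)).trans ?_
      rw [slReal_degree]; exact_mod_cast Nat.lt_succ_self _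
    have h4 : unitIntegral (slReal (m + 1) * derivative (slReal m)) = 0 := by
      apply slReal_orthogonal
      refine (degree_derivative_lt (hne _)).trans ?_
      rw [slReal_degree]; exact_mod_cast Nat.lt_succ_self _
    rw [h4, slReal_eval_one, slReal_eval_one, slReal_eval_zero, slReal_eval_zero,
      mul_comm (derivative _)] at h2
    rw [h3, h2] at h1
    have h5 : ((-1 : ℝ) ^ (m + 1)) * (-1) ^ m = -1 := by
      rw [pow_succ, mul_right_comm, ← mul_pow]; simp
    rw [h5] at h1
    push_cast
    field_simp
    linarith

lemma legendre_eq (j : ℕ) : legendre j = C ((-1) ^ j * √(2 * j + 1)) * slReal j := rfl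

lemma legendre_const_ne_zero (j : ℕ) : ((-1) ^ j * √(2 * j + 1) : ℝ) ≠ 0 := by
  have : (0 : ℝ) < √(2 * j + 1) := Real.sqrt_pos.2 (by positivity)
  exact mul_ne_zero (by simp) this.ne'

lemma legendre_degree (j : ℕ) : (legendre j).degree = j := by
  rw [legendre_eq, degree_C_mul (legendre_const_ne_zero j), slReal_degree]

lemma legendre_ne_zero (j : ℕ) : legendre j ≠ 0 := fun h => by
  simpa [h] using legendre_degree j

lemma legendre_orthogonal {n : ℕ} {q : ℝ[X]} (hq : q.degree < n) :
    unitIntegral (legendre n * q) = 0 := by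
  rw [legendre_eq, mul_assoc, unitIntegral_C_mul, slReal_orthogonal hq, mul_zero]

lemma legendre_orthonormal (i j : ℕ) :
    unitIntegral (legendre i * legendre j) = if i = j then 1 else 0 := by
  rcases lt_trichotomy i j with h | rfl | h
  · rw [if_neg h.ne, mul_comm, legendre_orthogonal]
    rw [legendre_degree]; exact_mod_cast h
  · rw [if_pos rfl, legendre_eq, mul_mul_mul_comm, ← C_mul, unitIntegral_C_mul, slReal_norm,
      mul_mul_mul_comm, Real.mul_self_sqrt (by positivity), ← mul_pow]
    have : (2 * i + 1 : ℝ) ≠ 0 := by positivity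
    field_simp
    simp
  · rw [if_neg h.ne', legendre_orthogonal]
    rw [legendre_degree]; exact_mod_cast h

/-! ### Antiderivatives of the Legendre polynomials. -/

/-- This and `xi_mul_pred` have the same right-hand side: after normalization both neighbours enter
the antiderivative with equal and opposite weight, giving a multiple of `slReal (m + 2) - slReal m`.
-/
lemma xi_mul_succ (m : ℕ) :
    xi (m + 2) * ((-1) ^ (m + 2) * √(2 * (m + 2 : ℕ) + 1)) = (-1) ^ m / (2 * √(2 * m + 3)) := by
  have h1 : (0 : ℝ) < √(2 * m + 5) := Real.sqrt_pos.2 (by positivity)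
  have h2 : (0 : ℝ) < √(2 * m + 3) := Real.sqrt_pos.2 (by positivity)
  have h3 : √((2 * ((m + 2 : ℕ) : ℝ) + 1) * (2 * ((m + 2 : ℕ) : ℝ) - 1)) =
      √(2 * m + 5) * √(2 * m + 3) := by
    rw [← Real.sqrt_mul (by positivity)]; push_cast; ring_nf
  rw [xi, h3, show (2 * ((m + 2 : ℕ) : ℝ) + 1) = 2 * m + 5 by push_cast; ring, pow_add]
  field_simp

lemma xi_mul_pred (m : ℕ) :
    xi (m + 1) * ((-1) ^ m * √(2 * m + 1)) = (-1) ^ m / (2 * √(2 * m + 3)) := by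
  have h1 : (0 : ℝ) < √(2 * m + 1) := Real.sqrt_pos.2 (by positivity)
  have h2 : (0 : ℝ) < √(2 * m + 3) := Real.sqrt_pos.2 (by positivity)
  have h3 : √((2 * ((m + 1 : ℕ) : ℝ) + 1) * (2 * ((m + 1 : ℕ) : ℝ) - 1)) =
      √(2 * m + 3) * √(2 * m + 1) := by
    rw [← Real.sqrt_mul (by positivity)]; push_cast; ring_nf
  rw [xi, h3]
  field_simp

/-- The antiderivative of `legendre j` that vanishes at `0`. -/
def legendreInt (j : ℕ) : ℝ[X] :=
  C (xi (j + 1)) * legendre (j + 1) +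
    if j = 0 then C (1 / 2) * legendre 0 else -(C (xi j) * legendre (j - 1))

lemma legendreInt_succ (m : ℕ) : legendreInt (m + 1) =
    C ((-1) ^ m / (2 * √(2 * m + 3))) * (slReal (m + 2) - slReal m) := by
  rw [legendreInt, if_neg (by omega), legendre_eq, legendre_eq, ← mul_assoc, ← mul_assoc, ← C_mul,
    ← C_mul, xi_mul_succ, show m + 1 - 1 = m by omega, xi_mul_pred]
  ring

lemma legendreInt_zero : legendreInt 0 = X := by
  have hs : slReal 1 = 1 - C 2 * X := by
    simp [slReal, shiftedLegendre, Finset.sum_range_succ, show (C 2 : ℝ[X]) = 2 from rfl]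
    ring
  have h3 : (0 : ℝ) < √3 := Real.sqrt_pos.2 (by norm_num)
  have hx : xi 1 * ((-1) ^ 1 * √(2 * (1 : ℕ) + 1)) = -(1 / 2) := by
    rw [xi]; norm_num
    field_simp
  rw [legendreInt, if_pos rfl, legendre_eq, legendre_eq, zero_add, ← mul_assoc, ← C_mul, hx, hs,
    slReal_zero]
  simp only [mul_sub, ← mul_assoc, ← C_mul]
  norm_num

lemma legendreInt_derivative (j : ℕ) : derivative (legendreInt j) = legendre j := by
  rcases j with _ | m
  · simp [legendreInt_zero, legendre_eq, slReal_zero]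
  · rw [legendreInt_succ, derivative_C_mul, slReal_derivative_sub, ← mul_assoc, ← C_mul,
      legendre_eq]
    congr 2
    have h2 : (0 : ℝ) < √(2 * m + 3) := Real.sqrt_pos.2 (by positivity)
    have h3 : √(2 * m + 3 : ℝ) ^ 2 = 2 * m + 3 := Real.sq_sqrt (by positivity)
    rw [show (2 * ((m + 1 : ℕ) : ℝ) + 1) = 2 * m + 3 by push_cast; ring,
      div_mul_eq_mul_div, div_eq_iff (by positivity), pow_succ]
    linear_combination 2 * (-1 : ℝ) ^ m * h3

lemma legendreInt_eval_zero (j : ℕ) : (legendreInt j).eval 0 = 0 := by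
  rcases j with _ | m
  · simp [legendreInt_zero]
  · rw [legendreInt_succ, eval_mul, (slReal_boundary m).2, mul_zero]

/-! ### Gauss nodes and quadrature. -/

lemma sign_of_roots_eq_zero {q : ℝ[X]} (hq : q ≠ 0) (hr : q.roots = 0) :
    (∀ x, 0 < q.eval x) ∨ ∀ x, q.eval x < 0 := by
  have hne : ∀ x, q.eval x ≠ 0 := fun x hx => by
    have : x ∈ q.roots := (mem_roots hq).2 hx
    simp [hr] at this
  by_contra! h
  obtain ⟨⟨x, hx⟩, y, hy⟩ := h
  obtain ⟨z, hz⟩ := mem_range_of_exists_le_of_exists_ge q.continuous ⟨x, hx⟩ ⟨y, hy⟩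
  exact hne z hz

/-- The integral of P_s·p = p²q would be positive, although P_s is orthogonal to p. This excludes
both too few real roots and multiple roots. -/
lemma legendre_mul_no_sign {s : ℕ} {p q : ℝ[X]} (h : p * q = legendre s) (hp : p.degree < s)
    (hq : ∀ x, 0 ≤ q.eval x) : False := by
  have h0 : legendre s * p ≠ 0 := by
    refine mul_ne_zero (legendre_ne_zero s) fun hp0 => legendre_ne_zero s ?_
    rw [← h, hp0, zero_mul]
  have h1 : 0 < unitIntegral (legendre s * p) := by
    refine unitIntegral_pos h0 fun x => ?_
    rw [← h, eval_mul, eval_mul]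
    nlinarith [mul_nonneg (mul_self_nonneg (p.eval x)) (hq x)]
  exact h1.ne' (legendre_orthogonal hp)

lemma legendre_card_roots (s : ℕ) : (legendre s).roots.card = s := by
  obtain ⟨q, hpq, hdeg, hroots⟩ := exists_prod_multiset_X_sub_C_mul (legendre s)
  have hnat : (legendre s).natDegree = s := natDegree_eq_of_degree_eq_some (legendre_degree s)
  rw [hnat] at hdeg
  by_contra hne
  have hq0 : q ≠ 0 := by
    rintro rfl
    exact legendre_ne_zero s (by rw [← hpq, mul_zero])
  set p := ((legendre s).roots.map fun a => X - C a).prod with hp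
  have hpdeg : p.degree < s := by
    have hpm : p.Monic := monic_multiset_prod_of_monic _ _ fun a _ => monic_X_sub_C a
    rw [degree_eq_natDegree hpm.ne_zero, hp, natDegree_multiset_prod_X_sub_C_eq_card]
    exact_mod_cast (by omega : (legendre s).roots.card < s)
  -- The cofactor of the real linear factors has no real root, hence constant sign.
  rcases sign_of_roots_eq_zero hq0 hroots with h | h
  · exact legendre_mul_no_sign hpq hpdeg fun x => (h x).le
  · refine legendre_mul_no_sign (p := -p) (q := -q) (by rw [neg_mul_neg, hpq])
      (by rwa [degree_neg]) fun x => ?_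
    rw [eval_neg]; linarith [h x]

lemma legendre_roots_nodup (s : ℕ) : (legendre s).roots.Nodup := by
  rw [Multiset.nodup_iff_count_le_one]
  intro a
  by_contra! h
  rw [count_roots] at h
  obtain ⟨q, hq⟩ := (le_rootMultiplicity_iff (legendre_ne_zero s)).1 (show 2 ≤ _ from h)
  have hq0 : q ≠ 0 := by
    rintro rfl
    exact legendre_ne_zero s (by rw [hq, mul_zero])
  refine legendre_mul_no_sign (p := q) (q := (X - C a) ^ 2) (by rw [hq, mul_comm]) ?_ fun x => ?_
  · have h1 := congrArg degree hq
    rw [legendre_degree, degree_mul, degree_pow, degree_X_sub_C, degree_eq_natDegree hq0] at h1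
    rw [degree_eq_natDegree hq0]
    have h2 : s = 2 + q.natDegree := by
      rw [nsmul_eq_mul, mul_one] at h1; exact_mod_cast h1
    exact_mod_cast (by omega : q.natDegree < s)
  · rw [eval_pow]; positivity

lemma length_sort_roots (s : ℕ) : ((legendre s).roots.sort (· ≤ ·)).length = s := by
  rw [Multiset.length_sort, legendre_card_roots]

lemma node_eq_getElem {s : ℕ} (i : Fin s) :
    node s i = ((legendre s).roots.sort (· ≤ ·))[(i : ℕ)]'(by rw [length_sort_roots]; exact i.2) :=
  List.getD_eq_getElem _ _ _

lemma legendre_eval_node {s : ℕ} (i : Fin s) : (legendre s).eval (node s i) = 0 := by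
  have h : node s i ∈ (legendre s).roots := by
    rw [← Multiset.mem_sort (r := (· ≤ ·)), node_eq_getElem]
    exact List.getElem_mem _
  exact (mem_roots (legendre_ne_zero s)).1 h

lemma node_injective (s : ℕ) : Function.Injective (node s) := by
  intro i j h
  have hnd : ((legendre s).roots.sort (· ≤ ·)).Nodup := by
    rw [← Multiset.coe_nodup, Multiset.sort_eq]
    exact legendre_roots_nodup s
  rw [node_eq_getElem, node_eq_getElem] at h
  exact Fin.ext ((hnd.getElem_inj_iff).1 h)

lemma eq_of_eval_node_eq {s : ℕ} {p q : ℝ[X]} (hp : p.degree < s) (hq : q.degree < s)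
    (h : ∀ i, p.eval (node s i) = q.eval (node s i)) : p = q :=
  eq_of_degrees_lt_of_eval_index_eq (s := Finset.univ) (v := node s)
    (node_injective s).injOn (by simpa using hp) (by simpa using hq) fun i _ => h i

lemma interpolatory_quadrature {s : ℕ} {p : ℝ[X]} (hp : p.degree < s) :
    ∑ i, weight s i * p.eval (node s i) = unitIntegral p := by
  have h := Lagrange.eq_interpolate (s := Finset.univ) (v := node s)
    (node_injective s).injOn (by simpa using hp)
  conv_rhs => rw [h, Lagrange.interpolate_apply, unitIntegral_sum]
  refine Finset.sum_congr rfl fun i _ => ?_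
  rw [unitIntegral_C_mul, mul_comm]; rfl

/-- The Gauss quadrature formula integrates polynomials of degree below `2 s` exactly. -/
lemma gauss_quadrature {s : ℕ} {p : ℝ[X]} (hp : p.degree < (2 * s : ℕ)) :
    ∑ i, weight s i * p.eval (node s i) = unitIntegral p := by
  -- Divide by P_s: the multiple of P_s has integral zero by orthogonality and vanishes at the
  -- nodes, so only the interpolatory remainder matters.
  have hdm := EuclideanDomain.div_add_mod p (legendre s)
  have hmod : (p % legendre s).degree < s := by
    rw [← legendre_degree s]; exact EuclideanDomain.mod_lt p (legendre_ne_zero s)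
  have hdiv : (p / legendre s).degree < s := by
    by_cases hlt : p.degree < (legendre s).degree
    · rw [(Polynomial.div_eq_zero_iff (legendre_ne_zero s)).2 hlt, degree_zero]
      exact WithBot.bot_lt_coe _
    · have h1 := degree_add_div (legendre_ne_zero s) (not_lt.1 hlt)
      rw [← h1, legendre_degree] at hp
      by_cases h0 : p / legendre s = 0
      · rw [h0, degree_zero]; exact WithBot.bot_lt_coe _
      · rw [degree_eq_natDegree h0] at hp ⊢
        have h2 : s + (p / legendre s).natDegree < 2 * s := by exact_mod_cast hp
        exact_mod_cast (by omega : (p / legendre s).natDegree < s)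
  conv_rhs => rw [← hdm, unitIntegral_add, legendre_orthogonal hdiv, zero_add]
  rw [← interpolatory_quadrature hmod]
  refine Finset.sum_congr rfl fun i _ => ?_
  conv_lhs => rw [← hdm, eval_add, eval_mul, legendre_eval_node, zero_mul, zero_add]

/-! ### The matrix 𝒫 and its product with X_s. -/

lemma degree_mul_lt {p q : ℝ[X]} {a b n : ℕ} (hp : p.degree ≤ a) (hq : q.degree ≤ b)
    (h : a + b < n) : (p * q).degree < n := by
  calc (p * q).degree ≤ a + b := degree_mul_le_of_le hp hq
    _ < n := by exact_mod_cast h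

/-- Orthonormality survives discretization because the products have degree at most 2s-2; so 𝒫⁻¹ =
𝒫ᵀ diag(b). -/
lemma legendreMatrix_left_inverse (s : ℕ) :
    (Matrix.of fun j i => weight s i * (legendre (j : Fin s)).eval (node s i)) *
      legendreMatrix s = 1 := by
  ext j k
  rw [Matrix.mul_apply, Matrix.one_apply]
  simp only [Matrix.of_apply, legendreMatrix]
  have h := gauss_quadrature (s := s) (p := legendre j * legendre k)
    (degree_mul_lt (legendre_degree j).le (legendre_degree k).le (by omega))
  rw [legendre_orthonormal] at h
  simp only [eval_mul, ← mul_assoc] at h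
  simp only [h, Fin.ext_iff]

lemma legendreMatrix_inv (s : ℕ) : (legendreMatrix s)⁻¹ =
    Matrix.of fun j i => weight s i * (legendre (j : Fin s)).eval (node s i) :=
  Matrix.inv_eq_left_inv (legendreMatrix_left_inverse s)

lemma legendreMatrix_isUnit (s : ℕ) : IsUnit (legendreMatrix s).det :=
  Matrix.isUnit_det_of_left_inverse (legendreMatrix_left_inverse s)

/-- Left multiplication by `𝒫⁻¹` computes Legendre coefficients. -/
lemma legendreMatrix_inv_mulVec {s : ℕ} {p : ℝ[X]} (hp : p.degree ≤ s) (j : Fin s) :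
    ∑ i, (legendreMatrix s)⁻¹ j i * p.eval (node s i) = unitIntegral (legendre j * p) := by
  rw [← gauss_quadrature (s := s) (degree_mul_lt (legendre_degree j).le hp (by omega)),
    legendreMatrix_inv]
  refine Finset.sum_congr rfl fun i _ => ?_
  rw [Matrix.of_apply, eval_mul, mul_assoc]

lemma weight_mul_legendreMatrix {s : ℕ} {p : ℝ[X]} (hp : p.degree ≤ s) (j : Fin s) :
    ∑ i, weight s i * p.eval (node s i) * legendreMatrix s i j = unitIntegral (legendre j * p) := by
  rw [← gauss_quadrature (s := s) (degree_mul_lt (legendre_degree j).le hp (by omega))]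
  refine Finset.sum_congr rfl fun i _ => ?_
  rw [legendreMatrix, Matrix.of_apply, eval_mul]; ring

lemma degree_C_mul_le' (a : ℝ) (p : ℝ[X]) : (C a * p).degree ≤ p.degree := by
  rw [← smul_eq_C_mul]; exact degree_smul_le a p

lemma legendre_expansion {s : ℕ} {p : ℝ[X]} (hp : p.degree < s) :
    p = ∑ j : Fin s, C (unitIntegral (legendre j * p)) * legendre j := by
  refine eq_of_eval_node_eq hp ?_ fun i => ?_
  · refine (degree_sum_le _ _).trans_lt ?_
    rw [Finset.sup_lt_iff (WithBot.bot_lt_coe _)]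
    intro j _
    refine (degree_C_mul_le' _ _).trans_lt ?_
    rw [legendre_degree]; exact_mod_cast j.2
  · have h1 : legendreMatrix s * (legendreMatrix s)⁻¹ = 1 :=
      Matrix.mul_nonsing_inv _ (legendreMatrix_isUnit s)
    have h2 := congrFun (congrArg (fun M => Matrix.mulVec M fun i => p.eval (node s i)) h1) i
    simp only [Matrix.one_mulVec, ← Matrix.mulVec_mulVec] at h2
    rw [← h2, eval_finsetSum, Matrix.mulVec, dotProduct]
    refine Finset.sum_congr rfl fun j _ => ?_
    rw [Matrix.mulVec, dotProduct, legendreMatrix_inv_mulVec hp.le, eval_mul, eval_C, mul_comm]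
    rfl

/-- The columns of X_s hold the Legendre coefficients of the antiderivatives. The last column lacks
its ξ_s P_s term, which is invisible at the zeros of P_s. -/
lemma legendreMatrix_mul_xMatrix {s : ℕ} (i j : Fin s) :
    (legendreMatrix s * xMatrix s) i j = (legendreInt j).eval (node s i) := by
  rw [Matrix.mul_apply]
  have hx : ∀ k : Fin s, legendreMatrix s i k * xMatrix s k j =
      (fun k : ℕ => (legendre k).eval (node s i) *
        ((if k = (j : ℕ) + 1 then xi (j + 1) else 0) +
          (if (j : ℕ) = 0 then (if k = 0 then 1 / 2 else 0)
            else if k = (j : ℕ) - 1 then -xi j else 0))) k := by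
    intro k
    simp only [legendreMatrix, xMatrix, Matrix.of_apply]
    congr 1
    split_ifs <;> first | omega | (simp; done) | (simp only [add_zero]; congr 1)
  rw [Finset.sum_congr rfl fun k _ => hx k,
    Fin.sum_univ_eq_sum_range (fun k : ℕ => (legendre k).eval (node s i) *
        ((if k = (j : ℕ) + 1 then xi (j + 1) else 0) +
          (if (j : ℕ) = 0 then (if k = 0 then 1 / 2 else 0)
            else if k = (j : ℕ) - 1 then -xi j else 0)))]
  -- The sum is extended to index s, where the summand vanishes at a node; the row j+1 = s then
  -- needs no separate case.
  have h1 := Finset.sum_range_succ (fun k : ℕ => (legendre k).eval (node s i) *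
        ((if k = (j : ℕ) + 1 then xi (j + 1) else 0) +
          (if (j : ℕ) = 0 then (if k = 0 then 1 / 2 else 0)
            else if k = (j : ℕ) - 1 then -xi j else 0))) s
  rw [legendre_eval_node, zero_mul, add_zero] at h1
  rw [← h1]
  have hj := j.2
  simp only [mul_add, Finset.sum_add_distrib, legendreInt, eval_add]
  congr 1
  · simp only [mul_ite, mul_zero]
    rw [Finset.sum_ite_eq' , if_pos (by simp), eval_mul, eval_C, mul_comm]
  · split_ifs
    · simp only [mul_ite, mul_zero]
      rw [Finset.sum_ite_eq' , if_pos (by simp), eval_mul, eval_C, mul_comm]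
    · simp only [mul_ite, mul_zero]
      rw [Finset.sum_ite_eq' , if_pos (by simp; omega), eval_neg, eval_mul, eval_C]
      ring

/-! ### The simplifying assumptions B(2s), C(s), D(s). -/

/-- The antiderivative of `p`, vanishing at `0`, for `p` of degree below `s`. -/
def antideriv (s : ℕ) (p : ℝ[X]) : ℝ[X] :=
  ∑ j : Fin s, C (unitIntegral (legendre j * p)) * legendreInt j

lemma antideriv_derivative {s : ℕ} {p : ℝ[X]} (hp : p.degree < s) :
    derivative (antideriv s p) = p := by
  conv_rhs => rw [legendre_expansion hp]
  rw [antideriv, derivative_sum]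
  simp only [derivative_C_mul, legendreInt_derivative]

lemma antideriv_eval_zero (s : ℕ) (p : ℝ[X]) : (antideriv s p).eval 0 = 0 := by
  simp [antideriv, eval_finsetSum, legendreInt_eval_zero]

lemma legendreInt_degree (j : ℕ) : (legendreInt j).degree ≤ (j + 1 : ℕ) := by
  refine (degree_add_le _ _).trans (max_le ?_ ?_)
  · exact (degree_C_mul_le' _ _).trans (legendre_degree _).le
  · split_ifs
    · refine (degree_C_mul_le' _ _).trans ((legendre_degree _).le.trans ?_)
      exact_mod_cast Nat.zero_le _
    · rw [degree_neg]
      refine (degree_C_mul_le' _ _).trans ((legendre_degree _).le.trans ?_)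
      exact_mod_cast (by omega)

lemma antideriv_degree (s : ℕ) (p : ℝ[X]) : (antideriv s p).degree ≤ s := by
  refine (degree_sum_le _ _).trans (Finset.sup_le fun j _ => ?_)
  refine (degree_C_mul_le' _ _).trans ((legendreInt_degree _).trans ?_)
  exact_mod_cast j.2

/-- The Gauss method integrates polynomials of degree below `s` exactly at the nodes. -/
lemma gauss_stage_quadrature {s : ℕ} {p : ℝ[X]} (hp : p.degree < s) (i : Fin s) :
    ∑ j, butcher s 0 i j * p.eval (node s j) = (antideriv s p).eval (node s i) := by
  rw [antideriv, eval_finsetSum]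
  have : ∀ j, butcher s 0 i j * p.eval (node s j) =
      ∑ k : Fin s, (legendreInt k).eval (node s i) * ((legendreMatrix s)⁻¹ k j * p.eval (node s j)) := by
    intro j
    rw [butcher, zero_smul, add_zero, Matrix.mul_apply, Finset.sum_mul]
    refine Finset.sum_congr rfl fun k _ => ?_
    rw [legendreMatrix_mul_xMatrix, mul_assoc]
  rw [Finset.sum_congr rfl fun j _ => this j, Finset.sum_comm]
  refine Finset.sum_congr rfl fun k _ => ?_
  rw [← Finset.mul_sum, legendreMatrix_inv_mulVec hp.le, eval_mul, eval_C, mul_comm]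

lemma degree_X_pow_lt {k s : ℕ} (h : k < s) : ((X : ℝ[X]) ^ k).degree < s := by
  rw [degree_X_pow]; exact_mod_cast h

lemma gauss_weight_moment {s k : ℕ} (hk : k < 2 * s) :
    ∑ i, weight s i * node s i ^ k = 1 / (k + 1) := by
  have h := gauss_quadrature (s := s) (degree_X_pow_lt hk)
  simp only [eval_pow, eval_X] at h
  rw [h, unitIntegral]
  simp

lemma gauss_stage_moment {s k : ℕ} (hk : k < s) (i : Fin s) :
    ∑ j, butcher s 0 i j * node s j ^ k = node s i ^ (k + 1) / (k + 1) := by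
  have h := gauss_stage_quadrature (degree_X_pow_lt hk) i
  simp only [eval_pow, eval_X] at h
  rw [h]
  have h2 : antideriv s (X ^ k) = C (1 / (k + 1 : ℝ)) * X ^ (k + 1) := by
    have hk0 : (k : ℝ) + 1 ≠ 0 := by positivity
    have hd : derivative (antideriv s (X ^ k) - C (1 / (k + 1 : ℝ)) * X ^ (k + 1)) = 0 := by
      rw [derivative_sub, antideriv_derivative (degree_X_pow_lt hk), derivative_C_mul,
        derivative_X_pow, ← mul_assoc, ← C_mul]
      push_cast
      rw [one_div_mul_cancel hk0]
      simp
    have h3 := eq_C_of_derivative_eq_zero hd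
    have h4 := coeff_zero_eq_eval_zero (antideriv s (X ^ k) - C (1 / (k + 1 : ℝ)) * X ^ (k + 1))
    rw [eval_sub, antideriv_eval_zero] at h4
    rw [h4] at h3
    simp at h3
    rw [← sub_eq_zero]
    simpa using h3
  rw [h2]
  simp
  ring

/-- This is D(s). Column j of the Butcher matrix samples the antiderivative of the Lagrange
polynomial ℓ_j. Integrating (t^(k+1))' against it by parts gives the claim, and both integrands have
degree at most 2s-1, so quadrature is exact. -/
lemma gauss_adjoint_moment {s k : ℕ} (hk : k + 1 ≤ s) (j : Fin s) :
    ∑ i, (k + 1) * weight s i * node s i ^ k * butcher s 0 i j =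
      weight s j * (1 - node s j ^ (k + 1)) := by
  set l := Lagrange.basis Finset.univ (node s) j with hl
  have hinj : Set.InjOn (node s) (Finset.univ : Finset (Fin s)) := (node_injective s).injOn
  have hld : l.degree = (s - 1 : ℕ) := by
    rw [hl, Lagrange.degree_basis hinj (Finset.mem_univ j)]; simp
  have hls : l.degree < s := by rw [hld]; exact_mod_cast (by omega : s - 1 < s)
  have hlj : l.eval (node s j) = 1 := Lagrange.eval_basis_self hinj (Finset.mem_univ j)
  have hlm : ∀ m, m ≠ j → l.eval (node s m) = 0 := fun m hm =>
    Lagrange.eval_basis_of_ne (Ne.symm hm) (Finset.mem_univ m)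
  have hpick : ∀ g : Fin s → ℝ, ∑ m, g m * l.eval (node s m) = g j := by
    intro g
    rw [Finset.sum_eq_single j (fun m _ hm => by rw [hlm m hm, mul_zero]) (by simp), hlj, mul_one]
  have hA : ∀ i, butcher s 0 i j = (antideriv s l).eval (node s i) := fun i => by
    rw [← gauss_stage_quadrature hls, hpick]
  have h1 := gauss_quadrature (s := s) (p := derivative (X ^ (k + 1)) * antideriv s l)
    (degree_mul_lt (a := k) (by
      rw [derivative_X_pow]; simpa using degree_C_mul_X_pow_le k (k + 1 : ℝ))
      (antideriv_degree s l) (by omega))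
  have h2 := gauss_quadrature (s := s) (p := X ^ (k + 1) * l)
    (degree_mul_lt (degree_X_pow_le _) hld.le (by omega))
  have h3 := unitIntegral_derivative (antideriv s l)
  rw [antideriv_derivative hls, antideriv_eval_zero, sub_zero] at h3
  rw [unitIntegral_derivative_mul, antideriv_derivative hls, ← h2, antideriv_eval_zero, ← h3] at h1
  simp only [eval_mul, ← mul_assoc] at h1
  rw [hpick fun m => weight s m * eval (node s m) (X ^ (k + 1))] at h1
  have h4 : unitIntegral l = weight s j := rfl
  rw [h4] at h1
  simp only [derivative_X_pow, eval_pow, eval_X, eval_mul, eval_C, one_pow, one_mul, mul_zero,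
    sub_zero, Nat.add_sub_cancel, Nat.cast_add, Nat.cast_one] at h1
  rw [mul_sub, mul_one, ← h1]
  refine Finset.sum_congr rfl fun i _ => ?_
  rw [hA]; ring

/-! ### Annihilation properties of the perturbation. -/

/-- The direction `𝒫 W_s 𝒫⁻¹` in which the Butcher matrix is perturbed. -/
def perturbation (s : ℕ) : Matrix (Fin s) (Fin s) ℝ :=
  legendreMatrix s * wMatrix s * (legendreMatrix s)⁻¹

lemma butcher_eq (s : ℕ) (α : ℝ) : butcher s α = butcher s 0 + α • perturbation s := by
  simp [butcher, perturbation, Matrix.mul_add, Matrix.add_mul]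

/-- With indices from 0, the two nonzero entries sit at (s-1, s-2) and (s-2, s-1), where the index
sum is 2s-3. -/
lemma wMatrix_eq_zero {s : ℕ} {k l : Fin s} (h : (k : ℕ) + l + 3 ≠ 2 * s) : wMatrix s k l = 0 := by
  have := k.2
  have := l.2
  simp only [wMatrix, Matrix.of_apply]
  split_ifs <;> first | omega | rfl

lemma legendre_X_pow_orthogonal {k j : ℕ} (h : k < j) : unitIntegral (legendre j * X ^ k) = 0 :=
  legendre_orthogonal (degree_X_pow_lt h)

/-- A monomial of degree k has Legendre modes only up to k < s-2, and W_s sees only the modes s-2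
and s-1. -/
lemma perturbation_right {s k : ℕ} (hk : k + 2 < s) (i : Fin s) :
    ∑ j, perturbation s i j * node s j ^ k = 0 := by
  have : ∀ j, perturbation s i j * node s j ^ k =
      ∑ m, (legendreMatrix s * wMatrix s) i m *
        ((legendreMatrix s)⁻¹ m j * (X ^ k : ℝ[X]).eval (node s j)) := by
    intro j
    rw [perturbation, Matrix.mul_apply, Finset.sum_mul]
    refine Finset.sum_congr rfl fun m _ => ?_
    simp [mul_assoc]
  rw [Finset.sum_congr rfl fun j _ => this j, Finset.sum_comm]
  refine Finset.sum_eq_zero fun m _ => ?_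
  rw [← Finset.mul_sum, legendreMatrix_inv_mulVec (degree_X_pow_lt (by omega)).le]
  by_cases hm : k < m
  · rw [legendre_X_pow_orthogonal hm, mul_zero]
  · rw [Matrix.mul_apply, Finset.sum_eq_zero, zero_mul]
    intro l _
    rw [wMatrix_eq_zero (by have := l.2; omega), mul_zero]

lemma perturbation_left_expansion {s k : ℕ} (hk : k ≤ s) (j : Fin s) :
    ∑ i, weight s i * node s i ^ k * perturbation s i j =
      ∑ m, unitIntegral (legendre (m : Fin s) * X ^ k) *
        (wMatrix s * (legendreMatrix s)⁻¹) m j := by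
  have : ∀ i, weight s i * node s i ^ k * perturbation s i j =
      ∑ m, weight s i * (X ^ k : ℝ[X]).eval (node s i) * legendreMatrix s i m *
        (wMatrix s * (legendreMatrix s)⁻¹) m j := by
    intro i
    rw [perturbation, Matrix.mul_assoc, Matrix.mul_apply, Finset.mul_sum]
    refine Finset.sum_congr rfl fun m _ => ?_
    simp [mul_assoc]
  rw [Finset.sum_congr rfl fun j _ => this j, Finset.sum_comm]
  refine Finset.sum_congr rfl fun m _ => ?_
  rw [← Finset.sum_mul, weight_mul_legendreMatrix]
  rw [degree_X_pow]; exact_mod_cast hk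

lemma perturbation_left {s k : ℕ} (hk : k + 2 < s) (j : Fin s) :
    ∑ i, weight s i * node s i ^ k * perturbation s i j = 0 := by
  rw [perturbation_left_expansion (by omega)]
  refine Finset.sum_eq_zero fun m _ => ?_
  by_cases hm : k < m
  · rw [legendre_X_pow_orthogonal hm, zero_mul]
  · rw [Matrix.mul_apply, Finset.sum_eq_zero, mul_zero]
    intro l _
    rw [wMatrix_eq_zero (by have := l.2; omega), zero_mul]

/-- The modes of t^k and t^l have index sum at most k+l, short of the 2s-3 that W_s requires. -/
lemma perturbation_bilinear {s k l : ℕ} (hkl : k + l + 3 < 2 * s) :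
    ∑ i, ∑ j, weight s i * node s i ^ k * perturbation s i j * node s j ^ l = 0 := by
  rcases lt_or_ge (l + 2) s with hl | hl
  · refine Finset.sum_eq_zero fun i _ => ?_
    simp only [mul_assoc, ← Finset.mul_sum]
    rw [perturbation_right hl, mul_zero, mul_zero]
  rcases lt_or_ge (k + 2) s with hk | hk
  · rw [Finset.sum_comm]
    refine Finset.sum_eq_zero fun j _ => ?_
    rw [← Finset.sum_mul, perturbation_left hk, zero_mul]
  -- Only k = l = s-2 is left here, so both monomials have degree below s and their Legendre
  -- coefficients are computed exactly.
  rw [Finset.sum_comm]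
  simp only [← Finset.sum_mul]
  simp only [perturbation_left_expansion (show k ≤ s by omega), Finset.sum_mul]
  rw [Finset.sum_comm]
  refine Finset.sum_eq_zero fun m _ => ?_
  by_cases hm : k < m
  · simp [legendre_X_pow_orthogonal hm]
  · simp only [Matrix.mul_apply, Finset.mul_sum, Finset.sum_mul]
    rw [Finset.sum_comm]
    refine Finset.sum_eq_zero fun r _ => ?_
    by_cases hr : l < r
    · have h := legendreMatrix_inv_mulVec (s := s) (degree_X_pow_lt (show l < s by omega)).le r
      rw [legendre_X_pow_orthogonal hr] at h
      simp only [eval_pow, eval_X] at h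
      simp only [mul_assoc, ← Finset.mul_sum]
      rw [h]; simp
    · rw [wMatrix_eq_zero (by omega)]; simp

/-! ### Taylor expansions and functionals supported on the nodes. -/

lemma pow_isBigO_pow {m n : ℕ} (h : m ≤ n) :
    (fun t : ℝ => t ^ n) =O[𝓝 0] fun t : ℝ => t ^ m := by
  obtain ⟨d, rfl⟩ := Nat.exists_eq_add_of_le h
  have h1 : (fun t : ℝ => t ^ d) =O[𝓝 0] fun _ : ℝ => (1 : ℝ) :=
    (continuous_pow d).continuousAt.isBigO_one ℝ
  simpa [pow_add] using (isBigO_refl (fun t : ℝ => t ^ m) (𝓝 0)).mul h1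

lemma tendsto_mul_left_zero (c : ℝ) : Tendsto (fun h : ℝ => c * h) (𝓝 0) (𝓝 0) := by
  simpa using (continuous_const_mul c).tendsto (0 : ℝ)

lemma isBigO_comp_mul {F : Type*} [NormedAddCommGroup F] {G : ℝ → F} {N : ℕ}
    (hG : G =O[𝓝 0] fun t : ℝ => t ^ N) (c : ℝ) :
    (fun h => G (c * h)) =O[𝓝 0] fun h : ℝ => h ^ N := by
  refine (hG.comp_tendsto (tendsto_mul_left_zero c)).trans ?_
  simp only [Function.comp_def, mul_pow]
  exact isBigO_const_mul_self _ _ _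

section Taylor

variable {F : Type*} [NormedAddCommGroup F] [NormedSpace ℝ F]

/-- `G(t) = ∑_{k<N} tᵏ aₖ + O(t^N)` as `t → 0`. -/
def HasTaylor (N : ℕ) (a : ℕ → F) (G : ℝ → F) : Prop :=
  (fun t => G t - ∑ k ∈ Finset.range N, t ^ k • a k) =O[𝓝 0] fun t : ℝ => t ^ N

lemma isBigO_of_hasDerivAt {g g' : ℝ → F} {N : ℕ} (hg : ∀ᶠ t in 𝓝 0, HasDerivAt g (g' t) t)
    (h0 : g 0 = 0) (hg' : g' =O[𝓝 0] fun t : ℝ => t ^ N) :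
    g =O[𝓝 0] fun t : ℝ => t ^ (N + 1) := by
  obtain ⟨C, hCpos, hC⟩ := hg'.exists_pos
  obtain ⟨ε, hε, hball⟩ := Metric.eventually_nhds_iff_ball.1 (hg.and hC.bound)
  refine IsBigO.of_bound C ?_
  filter_upwards [Metric.ball_mem_nhds (0 : ℝ) hε] with t ht
  have hsub : ∀ x ∈ Metric.closedBall (0 : ℝ) |t|, x ∈ Metric.ball (0 : ℝ) ε := by
    intro x hx
    rw [mem_closedBall_zero_iff, Real.norm_eq_abs] at hx
    rw [mem_ball_zero_iff, Real.norm_eq_abs] at ht ⊢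
    exact hx.trans_lt ht
  have hC0 : ∀ x ∈ Metric.closedBall (0 : ℝ) |t|, ‖g' x‖ ≤ C * |t| ^ N := by
    intro x hx
    refine ((hball x (hsub x hx)).2).trans ?_
    rw [norm_pow, Real.norm_eq_abs]
    rw [mem_closedBall_zero_iff, Real.norm_eq_abs] at hx
    gcongr
  have hmv := (convex_closedBall (0 : ℝ) |t|).norm_image_sub_le_of_norm_hasDerivWithin_le
    (f := g) (f' := g') (x := 0) (y := t)
    (fun x hx => (hball x (hsub x hx)).1.hasDerivWithinAt) hC0 (by simp) (by simp)
  rw [h0, sub_zero, sub_zero, Real.norm_eq_abs] at hmv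
  rw [norm_pow, Real.norm_eq_abs, pow_succ, ← mul_assoc]
  exact hmv

/-- The Taylor coefficients of an antiderivative. -/
def intCoeff (x : F) (a : ℕ → F) : ℕ → F
  | 0 => x
  | k + 1 => ((k : ℝ) + 1)⁻¹ • a k

lemma HasTaylor.integrate {g g' : ℝ → F} {N : ℕ} {a : ℕ → F}
    (hg : ∀ᶠ t in 𝓝 0, HasDerivAt g (g' t) t) (ha : HasTaylor N a g') :
    HasTaylor (N + 1) (intCoeff (g 0) a) g := by
  refine isBigO_of_hasDerivAt ?_ ?_ ha
  · filter_upwards [hg] with t ht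
    refine ht.sub ?_
    simp only [Finset.sum_range_succ' _ N, intCoeff, pow_zero]
    rw [← add_zero (∑ k ∈ Finset.range N, t ^ k • a k)]
    refine HasDerivAt.add (HasDerivAt.fun_sum fun k _ => ?_) (hasDerivAt_const _ _)
    have h1 := ((hasDerivAt_pow (k + 1) t).smul_const (((k : ℝ) + 1)⁻¹ • a k))
    have hk : (k : ℝ) + 1 ≠ 0 := by positivity
    convert h1 using 1
    rw [smul_smul, Nat.add_sub_cancel]
    congr 1
    push_cast
    field_simp
  · simp [Finset.sum_range_succ', intCoeff]

lemma exists_hasTaylor (N : ℕ) : ∀ G : ℝ → F, ContDiffAt ℝ N G 0 → ∃ a, HasTaylor N a G := by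
  induction N with
  | zero =>
    intro G hG
    refine ⟨0, ?_⟩
    simpa [HasTaylor] using hG.continuousAt.isBigO_one ℝ
  | succ N ih =>
    intro G hG
    have h1 : ContDiffAt ℝ N (deriv G) 0 := by
      have := hG.fderiv_right (m := N) (by exact_mod_cast le_rfl)
      exact this.clm_apply contDiffAt_const
    obtain ⟨a, ha⟩ := ih _ h1
    refine ⟨_, HasTaylor.integrate ?_ ha⟩
    have h2 : ContDiffAt ℝ 1 G 0 := hG.of_le (by exact_mod_cast (by omega))
    filter_upwards [h2.eventually (by simp)] with t ht
    exact (ht.differentiableAt (by simp)).hasDerivAt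

variable {ι : Type*} [Fintype ι]

/-- A linear functional supported on the nodes that annihilates `1, t, …, t^(N-1)` is of size
`O(h^N)` on rescaled smooth functions. -/
lemma nodal_functional_isBigO {w c : ι → ℝ} {N : ℕ} (hw : ∀ k < N, ∑ i, w i * c i ^ k = 0)
    {G : ℝ → F} (hG : ContDiffAt ℝ N G 0) :
    (fun h => ∑ i, w i • G (c i * h)) =O[𝓝 0] fun h : ℝ => h ^ N := by
  obtain ⟨a, ha⟩ := exists_hasTaylor N G hG
  have h1 : (fun h => ∑ i, w i • G (c i * h)) = fun h => ∑ i, w i •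
      (G (c i * h) - ∑ k ∈ Finset.range N, (c i * h) ^ k • a k) := by
    funext h
    simp only [smul_sub, Finset.sum_sub_distrib]
    rw [eq_comm, sub_eq_self]
    simp only [Finset.smul_sum]
    rw [Finset.sum_comm]
    refine Finset.sum_eq_zero fun k hk => ?_
    have : ∀ i, w i • (c i * h) ^ k • a k = (w i * c i ^ k) • h ^ k • a k := fun i => by
      rw [smul_smul, smul_smul, mul_pow, mul_assoc]
    simp only [this, ← Finset.sum_smul]
    rw [hw k (Finset.mem_range.1 hk), zero_smul]
  rw [h1]
  exact IsBigO.fun_sum fun i _ => (isBigO_comp_mul ha (c i)).const_smul_left (w i)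

/-- Exact moments match the Taylor polynomial of g' with its antiderivative; the factor h supplies
the extra order. It serves both the stages (x = c_i) and the full step (x = 1). -/
lemma quadrature_isBigO {w c : ι → ℝ} {x : ℝ} {N : ℕ}
    (hw : ∀ k < N, ∑ i, w i * c i ^ k = x ^ (k + 1) / (k + 1)) {g g' : ℝ → F}
    (hg : ∀ᶠ t in 𝓝 0, HasDerivAt g (g' t) t) (hg' : ContDiffAt ℝ N g' 0) :
    (fun h => h • ∑ i, w i • g' (c i * h) - (g (x * h) - g 0)) =O[𝓝 0]
      fun h : ℝ => h ^ (N + 1) := by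
  obtain ⟨a, ha⟩ := exists_hasTaylor N g' hg'
  have hS := isBigO_comp_mul (HasTaylor.integrate hg ha) x
  have hR : (fun h : ℝ => h • ∑ i, w i • (g' (c i * h) -
      ∑ k ∈ Finset.range N, (c i * h) ^ k • a k)) =O[𝓝 0] fun h : ℝ => h ^ (N + 1) := by
    simp only [pow_succ']
    exact (isBigO_refl (fun h : ℝ => h) (𝓝 0)).smul
      (IsBigO.fun_sum fun i _ => (isBigO_comp_mul ha (c i)).const_smul_left (w i))
  refine (hR.sub hS).congr_left fun h => ?_
  have h1 : h • ∑ i, w i • ∑ k ∈ Finset.range N, (c i * h) ^ k • a k =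
      ∑ k ∈ Finset.range N, (x * h) ^ (k + 1) • ((k : ℝ) + 1)⁻¹ • a k := by
    simp only [Finset.smul_sum]
    rw [Finset.sum_comm]
    refine Finset.sum_congr rfl fun k hk => ?_
    have : ∀ i, h • w i • (c i * h) ^ k • a k = (w i * c i ^ k) • h ^ (k + 1) • a k := fun i => by
      simp only [smul_smul]; congr 1; ring
    simp only [this, ← Finset.sum_smul]
    rw [hw k (Finset.mem_range.1 hk), smul_smul, smul_smul]
    congr 1
    ring
  simp only [smul_sub, Finset.sum_sub_distrib, h1, Finset.sum_range_succ', intCoeff, pow_zero,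
    one_smul]
  abel

/-- Only G is expanded. Its coefficient of h^l meets a functional of K that annihilates degrees
below N-l, so that term is h^l·O(h^(N-l)). -/
lemma nodal_bilinear_isBigO {E : Type*} [NormedAddCommGroup E] [NormedSpace ℝ E]
    {w : ι → ι → ℝ} {c : ι → ℝ} {N : ℕ}
    (hw : ∀ k l, k + l < N → ∑ i, ∑ j, w i j * c i ^ k * c j ^ l = 0)
    {K : ℝ → E →L[ℝ] F} {G : ℝ → E} (hK : ContDiffAt ℝ N K 0) (hG : ContDiffAt ℝ N G 0) :
    (fun h => ∑ i, ∑ j, w i j • K (c i * h) (G (c j * h))) =O[𝓝 0] fun h : ℝ => h ^ N := by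
  obtain ⟨a, ha⟩ := exists_hasTaylor N G hG
  have h1 : (fun h => ∑ i, ∑ j, w i j • K (c i * h) (G (c j * h) -
      ∑ l ∈ Finset.range N, (c j * h) ^ l • a l)) =O[𝓝 0] fun h : ℝ => h ^ N := by
    refine IsBigO.fun_sum fun i _ => IsBigO.fun_sum fun j _ => IsBigO.const_smul_left ?_ (w i j)
    have hb : (fun h => K (c i * h)) =O[𝓝 0] fun _ : ℝ => (1 : ℝ) :=
      (hK.continuousAt.isBigO_one ℝ).comp_tendsto (tendsto_mul_left_zero (c i))
    have hm : (fun h => ‖K (c i * h)‖ * ‖G (c j * h) -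
        ∑ l ∈ Finset.range N, (c j * h) ^ l • a l‖) =O[𝓝 0] fun h : ℝ => 1 * h ^ N :=
      hb.norm_left.mul (isBigO_comp_mul ha (c j)).norm_left
    simp only [one_mul] at hm
    refine (IsBigO.of_bound 1 (Eventually.of_forall fun h => ?_)).trans hm
    rw [one_mul, Real.norm_of_nonneg (by positivity)]
    exact ContinuousLinearMap.le_opNorm _ _
  have h2 : ∀ l ∈ Finset.range N, (fun h : ℝ => h ^ l •
      (∑ i, (∑ j, w i j * c j ^ l) • K (c i * h)) (a l)) =O[𝓝 0] fun h : ℝ => h ^ N := by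
    intro l hl
    have hl' := Finset.mem_range.1 hl
    have hn := nodal_functional_isBigO (w := fun i => ∑ j, w i j * c j ^ l) (c := c) (N := N - l)
      (fun k hk => by
        rw [← hw k l (by omega)]
        refine Finset.sum_congr rfl fun i _ => ?_
        rw [Finset.sum_mul]
        exact Finset.sum_congr rfl fun j _ => by ring) (hK.of_le (by exact_mod_cast Nat.sub_le N l))
    have hn' : (fun h : ℝ => (∑ i, (∑ j, w i j * c j ^ l) • K (c i * h)) (a l)) =O[𝓝 0]
        fun h : ℝ => h ^ (N - l) :=
      (IsBigO.of_bound ‖a l‖ (Eventually.of_forall fun h => by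
        rw [mul_comm]; exact ContinuousLinearMap.le_opNorm _ _)).trans hn
    have := (isBigO_refl (fun h : ℝ => h ^ l) (𝓝 0)).smul hn'
    refine this.congr_right fun h => ?_
    rw [smul_eq_mul, ← pow_add, Nat.add_sub_cancel' hl'.le]
  refine (h1.add (IsBigO.fun_sum h2)).congr_left fun h => ?_
  have h3 : ∑ i, ∑ j, w i j • K (c i * h) (∑ l ∈ Finset.range N, (c j * h) ^ l • a l) =
      ∑ l ∈ Finset.range N, h ^ l • (∑ i, (∑ j, w i j * c j ^ l) • K (c i * h)) (a l) := by
    simp only [map_sum, map_smul, sum_apply, smul_apply,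
      Finset.smul_sum, Finset.sum_smul]
    calc _ = ∑ i, ∑ l ∈ Finset.range N, ∑ j, w i j • (c j * h) ^ l • K (c i * h) (a l) :=
          Finset.sum_congr rfl fun i _ => Finset.sum_comm
      _ = ∑ l ∈ Finset.range N, ∑ i, ∑ j, w i j • (c j * h) ^ l • K (c i * h) (a l) :=
          Finset.sum_comm
      _ = _ := by
        refine Finset.sum_congr rfl fun l _ => Finset.sum_congr rfl fun i _ =>
          Finset.sum_congr rfl fun j _ => ?_
        simp only [smul_smul]
        congr 1
        ring
  simp only [map_sub, smul_sub, Finset.sum_sub_distrib, h3]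
  abel

end Taylor

/-! ### Approximate polynomial solution of the adjoint equation. -/

section AdjointSeries

variable {A : Type*} [NormedRing A] [NormedAlgebra ℝ A]

/-- The coefficients of the formal solution of `M' = -M J`, `M(0) = 1`, with `J = ∑ tᵏ aₖ`. -/
def adjointCoeff (a : ℕ → A) : ℕ → A
  | 0 => 1
  | k + 1 => -(((k : ℝ) + 1)⁻¹ • ∑ i : Fin (k + 1), adjointCoeff a i * a (k - i))

lemma adjointCoeff_succ (a : ℕ → A) (k : ℕ) : ((k : ℝ) + 1) • adjointCoeff a (k + 1) =
    -∑ p ∈ Finset.HasAntidiagonal.antidiagonal k, adjointCoeff a p.1 * a p.2 := by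
  have hk : (k : ℝ) + 1 ≠ 0 := by positivity
  rw [adjointCoeff, smul_neg, smul_inv_smul₀ hk,
    Finset.Nat.sum_antidiagonal_eq_sum_range_succ fun i j => adjointCoeff a i * a j,
    Fin.sum_univ_eq_sum_range fun i => adjointCoeff a i * a (k - i)]

/-- The polynomial `∑_{k<n} tᵏ mₖ`. -/
def polyFun (m : ℕ → A) (n : ℕ) (t : ℝ) : A := ∑ k ∈ Finset.range n, t ^ k • m k

/-- The derivative of `polyFun`. -/
def polyFunDeriv (m : ℕ → A) (n : ℕ) (t : ℝ) : A :=
  ∑ k ∈ Finset.range n, (k * t ^ (k - 1)) • m k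

lemma polyFun_hasDerivAt (m : ℕ → A) (n : ℕ) (t : ℝ) :
    HasDerivAt (polyFun m n) (polyFunDeriv m n t) t :=
  HasDerivAt.fun_sum fun k _ => (hasDerivAt_pow k t).smul_const (m k)

lemma polyFun_contDiff (m : ℕ → A) (n : ℕ) {k : WithTop ℕ∞} : ContDiff ℝ k (polyFun m n) :=
  ContDiff.sum fun _ _ => (contDiff_id.pow _).smul contDiff_const

lemma polyFunDeriv_contDiff (m : ℕ → A) (n : ℕ) {k : WithTop ℕ∞} :
    ContDiff ℝ k (polyFunDeriv m n) :=
  ContDiff.sum fun _ _ => (contDiff_const.mul (contDiff_id.pow _)).smul contDiff_const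

lemma sum_range_antidiagonal {B : Type*} [AddCommMonoid B] (N : ℕ) (g : ℕ × ℕ → B) :
    ∑ k ∈ Finset.range N, ∑ p ∈ Finset.HasAntidiagonal.antidiagonal k, g p =
      ∑ p ∈ (Finset.range (N + 1) ×ˢ Finset.range N) with p.1 + p.2 < N, g p := by
  rw [← Finset.sum_fiberwise_of_maps_to (g := fun p : ℕ × ℕ => p.1 + p.2) (t := Finset.range N)
    (fun p hp => by simpa using (Finset.mem_filter.1 hp).2)]
  refine Finset.sum_congr rfl fun k hk => Finset.sum_congr ?_ fun _ _ => rfl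
  ext ⟨i, j⟩
  simp only [Finset.HasAntidiagonal.mem_antidiagonal, Finset.mem_filter, Finset.mem_product, Finset.mem_range] at *
  omega

/-- A polynomial solving the adjoint linear equation `M' = -M J` up to `O(t^N)`. -/
lemma exists_adjoint_polyFun {N : ℕ} {J : ℝ → A} (hJ : ContDiffAt ℝ N J 0) :
    ∃ m : ℕ → A, m 0 = 1 ∧
      (fun t => polyFunDeriv m (N + 1) t + polyFun m (N + 1) t * J t) =O[𝓝 0]
        fun t : ℝ => t ^ N := by
  obtain ⟨a, ha⟩ := exists_hasTaylor N J hJ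
  refine ⟨adjointCoeff a, by rw [adjointCoeff], ?_⟩
  set m := adjointCoeff a with hm
  have h1 : (fun t => polyFun m (N + 1) t * (J t - ∑ k ∈ Finset.range N, t ^ k • a k)) =O[𝓝 0]
      fun t : ℝ => t ^ N := by
    have := ((polyFun_contDiff (k := 0) m (N + 1)).continuous.continuousAt (x := 0)).isBigO_one ℝ
    simpa using this.mul ha
  -- Of the product of the two polynomials, the terms of total degree below N cancel the derivative
  -- by the recursion; this is the remaining part, already O(t^N).
  have h2 : (fun t : ℝ => ∑ p ∈ (Finset.range (N + 1) ×ˢ Finset.range N) with ¬ p.1 + p.2 < N,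
      t ^ (p.1 + p.2) • (m p.1 * a p.2)) =O[𝓝 0] fun t : ℝ => t ^ N := by
    refine IsBigO.fun_sum fun p hp => ?_
    have hp' : N ≤ p.1 + p.2 := not_lt.1 (Finset.mem_filter.1 hp).2
    refine IsBigO.trans ?_ (pow_isBigO_pow hp')
    refine IsBigO.of_bound ‖m p.1 * a p.2‖ (Eventually.of_forall fun t => ?_)
    rw [norm_smul, mul_comm]
  refine (h1.add h2).congr_left fun t => ?_
  have h3 : polyFunDeriv m (N + 1) t =
      -∑ p ∈ (Finset.range (N + 1) ×ˢ Finset.range N) with p.1 + p.2 < N,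
        t ^ (p.1 + p.2) • (m p.1 * a p.2) := by
    rw [← sum_range_antidiagonal, polyFunDeriv, Finset.sum_range_succ', ← Finset.sum_neg_distrib]
    simp only [Nat.cast_zero, zero_mul, zero_smul, add_zero]
    refine Finset.sum_congr rfl fun k _ => ?_
    have := adjointCoeff_succ a k
    rw [Nat.add_sub_cancel, mul_comm, mul_smul]
    push_cast
    rw [this, smul_neg, Finset.smul_sum]
    congr 1
    refine Finset.sum_congr rfl fun p hp => ?_
    rw [Finset.HasAntidiagonal.mem_antidiagonal.1 hp]
  have h4 : polyFun m (N + 1) t * ∑ k ∈ Finset.range N, t ^ k • a k =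
      ∑ p ∈ (Finset.range (N + 1) ×ˢ Finset.range N), t ^ (p.1 + p.2) • (m p.1 * a p.2) := by
    rw [polyFun, Finset.sum_mul_sum, ← Finset.sum_product']
    refine Finset.sum_congr rfl fun p _ => ?_
    rw [smul_mul_smul_comm, pow_add]
  have h5 := Finset.sum_filter_add_sum_filter_not (Finset.range (N + 1) ×ˢ Finset.range N)
    (fun p : ℕ × ℕ => p.1 + p.2 < N) (fun p => t ^ (p.1 + p.2) • (m p.1 * a p.2))
  rw [mul_sub, h4, h3, ← h5]
  abel

end AdjointSeries

/-! ### Regularity of the solution and local bounds on the vector field. -/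

section Regularity

variable {E : Type*} [NormedAddCommGroup E] [NormedSpace ℝ E]

/-- Bootstrap: if y is C^n then so is y' = f(y), hence y is C^(n+1). -/
lemma contDiffAt_of_ode {f : E → E} {y : ℝ → E} {t₀ : ℝ} {p : ℕ} (hf : ContDiffAt ℝ p f (y t₀))
    (hy : ∀ᶠ t in 𝓝 t₀, HasDerivAt y (f (y t)) t) : ContDiffAt ℝ p y t₀ := by
  suffices h : ∀ n : ℕ, n ≤ p → ContDiffAt ℝ n y t₀ from h p le_rfl
  intro n
  induction n with
  | zero =>
    intro _
    rw [Nat.cast_zero, contDiffAt_zero]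
    obtain ⟨u, hu, hcont⟩ := eventually_iff_exists_mem.1 hy
    exact ⟨u, hu, fun t ht => (hcont t ht).continuousAt.continuousWithinAt⟩
  | succ n ih =>
    intro hn
    have h1 : ContDiffAt ℝ n (fun t => f (y t)) t₀ :=
      ContDiffAt.comp t₀ (hf.of_le (by exact_mod_cast (by omega : n ≤ p))) (ih (by omega))
    push_cast
    rw [contDiffAt_succ_iff_hasFDerivAt]
    obtain ⟨u, hu, hder⟩ := eventually_iff_exists_mem.1 hy
    refine ⟨fun t => ContinuousLinearMap.toSpanSingleton ℝ (f (y t)),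
      ⟨u, hu, fun t ht => (hder t ht).hasFDerivAt⟩, ?_⟩
    exact (ContinuousLinearMap.toSpanSingletonCLE (𝕜 := ℝ) (E := E)).contDiff.contDiffAt.comp t₀ h1

/-- A ball on which a `C²` vector field is Lipschitz, with a quadratic Taylor remainder. -/
lemma exists_ball_estimates {f : E → E} {y₀ : E} {U : Set E} (hU : U ∈ 𝓝 y₀)
    (hf : ContDiffAt ℝ 2 f y₀) :
    ∃ r > 0, Metric.closedBall y₀ r ⊆ U ∧ ∃ K : NNReal,
      LipschitzOnWith K f (Metric.closedBall y₀ r) ∧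
      ∀ u ∈ Metric.closedBall y₀ r, ∀ v ∈ Metric.closedBall y₀ r,
        ‖f u - f v - fderiv ℝ f v (u - v)‖ ≤ K * ‖u - v‖ ^ 2 := by
  obtain ⟨K₁, t₁, ht₁, hL₁⟩ := (hf.of_le (by norm_num : (1 : WithTop ℕ∞) ≤ 2)).exists_lipschitzOnWith
  have hfd : ContDiffAt ℝ 1 (fderiv ℝ f) y₀ := hf.fderiv_right (by norm_num)
  obtain ⟨K₂, t₂, ht₂, hL₂⟩ := hfd.exists_lipschitzOnWith
  have hdiff : ∀ᶠ x in 𝓝 y₀, DifferentiableAt ℝ f x := by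
    filter_upwards [hf.eventually (by simp)] with x hx
    exact hx.differentiableAt (by simp)
  obtain ⟨r, hr, hsub⟩ := Metric.nhds_basis_closedBall.mem_iff.1
    (inter_mem (inter_mem hU hdiff) (inter_mem ht₁ ht₂))
  refine ⟨r, hr, fun x hx => (hsub hx).1.1, max K₁ K₂, ?_, ?_⟩
  · exact (hL₁.mono fun x hx => (hsub hx).2.1).weaken (le_max_left _ _)
  · intro u hu v hv
    have hseg : segment ℝ v u ⊆ Metric.closedBall y₀ r :=
      (convex_closedBall y₀ r).segment_subset hv hu
    have h := (convex_segment v u).norm_image_sub_le_of_norm_hasFDerivWithin_le'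
      (f := f) (f' := fderiv ℝ f) (φ := fderiv ℝ f v) (C := K₂ * ‖u - v‖) (x := v) (y := u)
      (fun x hx => ((hsub (hseg hx)).1.2).hasFDerivAt.hasFDerivWithinAt) (fun x hx => by
        have h1 := hL₂.norm_sub_le (hsub (hseg hx)).2.2 (hsub hv).2.2
        refine h1.trans ?_
        gcongr
        obtain ⟨a, b, ha, hb, hab, rfl⟩ := hx
        have : a • v + b • u - v = b • (u - v) := by
          rw [show a = 1 - b by linarith]; module
        rw [this, norm_smul, Real.norm_of_nonneg hb]
        exact mul_le_of_le_one_left (norm_nonneg _) (by linarith))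
      (left_mem_segment ℝ v u) (right_mem_segment ℝ v u)
    refine h.trans ?_
    rw [mul_assoc, ← sq]
    gcongr
    exact le_max_right _ _

end Regularity

/-! ### Solvability of the stage equations. -/

section Stages

variable {E : Type*} [NormedAddCommGroup E] [NormedSpace ℝ E] [CompleteSpace E] {s : ℕ}

/-- Banach's fixed point theorem on the product of closed balls. All that is needed of the
h-dependent matrix is that h·A(h) tends to 0. -/
lemma existsUnique_stages {f : E → E} {y₀ : E} {r : ℝ} (hr : 0 < r) {K : NNReal}
    (hf : LipschitzOnWith K f (Metric.closedBall y₀ r)) {A : ℝ → Matrix (Fin s) (Fin s) ℝ}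
    (hA : ∀ i j, Tendsto (fun h => h * A h i j) (𝓝 0) (𝓝 0)) :
    ∀ᶠ h in 𝓝 (0 : ℝ), ∃! Y : Fin s → E,
      (∀ i, Y i ∈ Metric.closedBall y₀ r) ∧ IsStages (A h) f h y₀ Y := by
  have hsum : Tendsto (fun h => ∑ i, ∑ j, |h * A h i j|) (𝓝 0) (𝓝 0) := by
    have := tendsto_finsetSum Finset.univ fun i _ => tendsto_finsetSum Finset.univ
      fun j _ => (hA i j).abs
    simpa using this
  -- The added 1 keeps L and M positive, so they may be divided by. M bounds f on the ball; the
  -- first smallness condition yields contraction factor 1/2, the second invariance of the ball.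
  set L : ℝ := K + 1 with hL
  have hL0 : 0 < L := by positivity
  have hKL : (K : ℝ) ≤ L := by linarith
  set M : ℝ := ‖f y₀‖ + L * r with hM
  have hM0 : 0 < M := by positivity
  have e1 : ∀ᶠ h in 𝓝 (0 : ℝ), ∑ i, ∑ j, |h * A h i j| < 1 / (2 * L) :=
    hsum.eventually_lt_const (by positivity)
  have e2 : ∀ᶠ h in 𝓝 (0 : ℝ), ∑ i, ∑ j, |h * A h i j| < r / M :=
    hsum.eventually_lt_const (by positivity)
  filter_upwards [e1, e2] with h h1 h2
  set S := ∑ i, ∑ j, |h * A h i j| with hS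
  have hrow : ∀ i, ∑ j, |h * A h i j| ≤ S := fun i =>
    Finset.single_le_sum (f := fun i => ∑ j, |h * A h i j|)
      (fun i _ => Finset.sum_nonneg fun j _ => abs_nonneg _) (Finset.mem_univ i)
  let Φ : (Fin s → E) → (Fin s → E) := fun Y i => y₀ + h • ∑ j, A h i j • f (Y j)
  have hy₀ : y₀ ∈ Metric.closedBall y₀ r := Metric.mem_closedBall_self hr.le
  let B : Set (Fin s → E) := {Y | ∀ i, Y i ∈ Metric.closedBall y₀ r}
  have hB : IsClosed B := by
    simp only [B, Set.ofPred_forall]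
    exact isClosed_iInter fun i => Metric.isClosed_closedBall.preimage (continuous_apply i)
  have hmaps : Set.MapsTo Φ B B := by
    intro Y hY i
    rw [mem_closedBall_iff_norm]
    simp only [Φ, add_sub_cancel_left, Finset.smul_sum, smul_smul]
    have hb : ∀ j, ‖f (Y j)‖ ≤ M := fun j => by
      have h3 := hf.norm_sub_le (hY j) hy₀
      have h4 := mem_closedBall_iff_norm.1 (hY j)
      have h5 : ‖f (Y j)‖ ≤ ‖f y₀‖ + ‖f (Y j) - f y₀‖ := norm_le_norm_add_norm_sub' _ _
      have h6 : K * ‖Y j - y₀‖ ≤ L * r := mul_le_mul hKL h4 (norm_nonneg _) hL0.le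
      linarith
    calc ‖∑ j, (h * A h i j) • f (Y j)‖ ≤ ∑ j, |h * A h i j| * M :=
          norm_sum_le_of_le _ fun j _ => by
            rw [norm_smul, Real.norm_eq_abs]
            exact mul_le_mul_of_nonneg_left (hb j) (abs_nonneg _)
      _ ≤ S * M := by rw [← Finset.sum_mul]; exact mul_le_mul_of_nonneg_right (hrow i) hM0.le
      _ ≤ r := ((lt_div_iff₀ hM0).1 h2).le
  have hlip : LipschitzWith (1 / 2 : NNReal) (hmaps.restrict Φ B B) := by
    refine LipschitzWith.of_dist_le_mul fun Y Z => ?_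
    rw [Subtype.dist_eq, dist_pi_le_iff (by positivity)]
    intro i
    simp only [Set.MapsTo.val_restrict_apply, Φ, dist_eq_norm]
    rw [add_sub_add_left_eq_sub, ← smul_sub, ← Finset.sum_sub_distrib]
    simp only [← smul_sub, Finset.smul_sum, smul_smul]
    have hd : ∀ j, ‖f (Y.1 j) - f (Z.1 j)‖ ≤ L * dist Y Z := fun j => by
      refine (hf.norm_sub_le (Y.2 j) (Z.2 j)).trans ?_
      rw [← dist_eq_norm]
      exact mul_le_mul hKL (dist_le_pi_dist Y.1 Z.1 j) dist_nonneg hL0.le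
    calc ‖∑ j, (h * A h i j) • (f (Y.1 j) - f (Z.1 j))‖
        ≤ ∑ j, |h * A h i j| * (L * dist Y Z) :=
          norm_sum_le_of_le _ fun j _ => by
            rw [norm_smul, Real.norm_eq_abs]
            exact mul_le_mul_of_nonneg_left (hd j) (abs_nonneg _)
      _ ≤ S * (L * dist Y Z) := by
          rw [← Finset.sum_mul]
          exact mul_le_mul_of_nonneg_right (hrow i) (by positivity)
      _ ≤ (1 / 2 : NNReal) * dist Y Z := by
          rw [← mul_assoc]
          refine mul_le_mul_of_nonneg_right ?_ dist_nonneg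
          have := (lt_div_iff₀ (by positivity)).1 h1
          push_cast
          linarith
  have hcontr : ContractingWith (1 / 2 : NNReal) (hmaps.restrict Φ B B) :=
    ⟨by rw [← NNReal.coe_lt_coe]; push_cast; norm_num, hlip⟩
  have hfix : ∀ Y, IsStages (A h) f h y₀ Y ↔ Φ Y = Y := fun Y =>
    ⟨fun hY => funext fun i => (hY i).symm, fun hY i => (congrFun hY i).symm⟩
  have : CompleteSpace B := hB.completeSpace_coe
  have : Nonempty B := ⟨⟨fun _ => y₀, fun _ => hy₀⟩⟩
  refine ⟨(hcontr.fixedPoint _).1, ⟨(hcontr.fixedPoint _).2, ?_⟩, ?_⟩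
  · rw [hfix]
    exact congrArg Subtype.val hcontr.fixedPoint_isFixedPt
  · rintro Y ⟨hY, hYs⟩
    rw [hfix] at hYs
    exact congrArg Subtype.val (hcontr.fixedPoint_unique (x := ⟨Y, hY⟩) (Subtype.ext hYs))

end Stages

/-! ### Error of the stages and of the step. -/

/-- If `x = p + q` with `p = O(g)` and `q = o(x)`, then `x = O(g)`. -/
lemma isBigO_of_add_isLittleO {E : Type*} [NormedAddCommGroup E] {x p q : ℝ → E} {g : ℝ → ℝ} {l : Filter ℝ}
    (hx : ∀ᶠ h in l, x h = p h + q h) (hp : p =O[l] g) (hq : q =o[l] x) : x =O[l] g := by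
  refine (hq.right_isBigO_sub.congr' EventuallyEq.rfl ?_).trans hp
  filter_upwards [hx] with h hh
  rw [hh]; abel

section ErrorAnalysis

variable {E : Type*} [NormedAddCommGroup E] [NormedSpace ℝ E] {s : ℕ}

lemma isBigO_clm_apply {G : Type*} [NormedAddCommGroup G] [NormedSpace ℝ G] {l : Filter ℝ}
    {K : ℝ → E →L[ℝ] G} {x : ℝ → E} {u w : ℝ → ℝ} (hK : K =O[l] u) (hx : x =O[l] w) :
    (fun h => K h (x h)) =O[l] fun h => u h * w h := by
  refine (IsBigO.of_bound 1 (Eventually.of_forall fun h => ?_)).trans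
    (hK.norm_left.mul hx.norm_left)
  rw [one_mul, Real.norm_of_nonneg (by positivity)]
  exact ContinuousLinearMap.le_opNorm _ _

variable {A B : Matrix (Fin s) (Fin s) ℝ} {b c : Fin s → ℝ} {y v : ℝ → E} {β : ℝ → ℝ}
  {Y F : Fin s → ℝ → E}

/-- P is the residual of the exact solution in the stage equations. Q depends on the stage errors
through the small factors h and β, hence is o(Z) and can be absorbed. -/
lemma stage_error_isBigO
    (hC : ∀ k < s, ∀ i, ∑ j, A i j * c j ^ k = c i ^ (k + 1) / (k + 1))
    (hBr : ∀ k, k + 2 < s → ∀ i, ∑ j, B i j * c j ^ k = 0)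
    (hv : ContDiffAt ℝ s v 0) (hy : ∀ᶠ t in 𝓝 0, HasDerivAt y (v t) t)
    (hβ : β =O[𝓝 0] fun h : ℝ => h ^ 3)
    (hY : ∀ᶠ h in 𝓝 0, ∀ i,
      Y i h = y 0 + h • ∑ j, A i j • F j h + β h • ∑ j, B i j • F j h)
    (hF : ∀ i, (fun h => F i h - v (c i * h)) =O[𝓝 0] fun h => Y i h - y (c i * h)) (i : Fin s) :
    (fun h => Y i h - y (c i * h)) =O[𝓝 0] fun h : ℝ => h ^ (s + 1) := by
  set Z : ℝ → Fin s → E := fun h i => Y i h - y (c i * h) with hZ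
  set P : ℝ → Fin s → E := fun h i => h • ∑ j, A i j • v (c j * h) - (y (c i * h) - y 0) +
    β h • ∑ j, B i j • v (c j * h) with hP
  set Q : ℝ → Fin s → E := fun h i => h • ∑ j, A i j • (F j h - v (c j * h)) +
    β h • ∑ j, B i j • (F j h - v (c j * h)) with hQ
  have hD : ∀ j, (fun h => F j h - v (c j * h)) =O[𝓝 0] Z := fun j =>
    (hF j).trans (IsBigO.of_bound 1 (Eventually.of_forall fun h => by
      rw [one_mul]; exact norm_le_pi_norm (Z h) j))
  have hsumD : ∀ w : Fin s → ℝ, (fun h => ∑ j, w j • (F j h - v (c j * h))) =O[𝓝 0] Z := fun w =>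
    IsBigO.fun_sum fun j _ => (hD j).const_smul_left (w j)
  have hid : (fun h : ℝ => h) =o[𝓝 0] fun _ : ℝ => (1 : ℝ) :=
    (isLittleO_one_iff ℝ).2 tendsto_id
  have hβ1 : β =o[𝓝 0] fun _ : ℝ => (1 : ℝ) :=
    ((hβ.trans (pow_isBigO_pow (show 1 ≤ 3 by norm_num))).congr_right
      fun h => pow_one h).trans_isLittleO hid
  have hQo : Q =o[𝓝 0] Z := by
    rw [isLittleO_pi]
    intro i
    have h1 := hid.smul_isBigO (hsumD (A i))
    have h2 := hβ1.smul_isBigO (hsumD (B i))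
    simpa using h1.add h2
  have hPO : P =O[𝓝 0] fun h : ℝ => h ^ (s + 1) := by
    rw [isBigO_pi]
    intro i
    have h1 := quadrature_isBigO (w := A i) (c := c) (x := c i) (fun k hk => hC k hk i) hy hv
    -- The subtraction truncates at s = 1; there β = O(h^3) alone is more than enough.
    have h2 := nodal_functional_isBigO (w := B i) (c := c) (N := s - 2)
      (fun k hk => hBr k (by omega) i) (hv.of_le (by exact_mod_cast Nat.sub_le s 2))
    have h3 : (fun h => β h • ∑ j, B i j • v (c j * h)) =O[𝓝 0] fun h : ℝ => h ^ (s + 1) := by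
      refine (hβ.smul h2).trans ?_
      simp only [smul_eq_mul, ← pow_add]
      exact pow_isBigO_pow (by omega)
    exact h1.add h3
  have hZO : Z =O[𝓝 0] fun h : ℝ => h ^ (s + 1) := by
    refine isBigO_of_add_isLittleO ?_ hPO hQo
    filter_upwards [hY] with h hh
    funext i
    simp only [hZ, hP, hQ, Pi.add_apply, hh i, smul_sub, Finset.sum_sub_distrib]
    abel
  exact isBigO_pi.1 hZO i

/-- Summation by parts for the discrete method, from the adjoint simplifying assumption. -/
lemma polyFun_apply_weighted_sum
    (hD : ∀ k, k + 1 ≤ s → ∀ j,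
      ∑ i, (k + 1) * b i * c i ^ k * A i j = b j * (1 - c j ^ (k + 1)))
    (m : ℕ → E →L[ℝ] E) (F : Fin s → E) (h : ℝ) :
    polyFun m s h (∑ i, b i • F i) = ∑ i, b i • polyFun m s (c i * h) (F i) +
      ∑ i, b i • polyFunDeriv m s (c i * h) (h • ∑ j, A i j • F j) := by
  have key : ∀ k < s, h ^ k • ∑ i, b i • F i = ∑ i, b i • (c i * h) ^ k • F i +
      ∑ i, b i • (k * (c i * h) ^ (k - 1)) • h • ∑ j, A i j • F j := by
    intro k hk
    rcases k with _ | k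
    · simp
    · simp only [Finset.smul_sum]
      rw [Finset.sum_comm (γ := Fin s), ← Finset.sum_add_distrib]
      refine Finset.sum_congr rfl fun j _ => ?_
      simp only [smul_smul, ← Finset.sum_smul, ← add_smul]
      congr 1
      have h1 : ∑ i, b i * ((k + 1 : ℕ) * (c i * h) ^ (k + 1 - 1)) * (h * A i j) =
          h ^ (k + 1) * (b j * (1 - c j ^ (k + 1))) := by
        rw [← hD k hk.le j, Finset.mul_sum]
        refine Finset.sum_congr rfl fun i _ => ?_
        rw [Nat.add_sub_cancel]
        push_cast
        ring
      have h2 : ∑ i, b i * ((k + 1 : ℕ) * (c i * h) ^ (k + 1 - 1) * (h * A i j)) =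
          h ^ (k + 1) * (b j * (1 - c j ^ (k + 1))) := by
        rw [← h1]; exact Finset.sum_congr rfl fun i _ => by ring
      simp only [mul_assoc] at h1 h2 ⊢
      rw [h2]
      ring
  have e1 : ∀ i, b i • polyFun m s (c i * h) (F i) =
      ∑ k ∈ Finset.range s, m k (b i • (c i * h) ^ k • F i) := fun i => by
    simp [polyFun, sum_apply, Finset.smul_sum]
  have e2 : ∀ i, b i • polyFunDeriv m s (c i * h) (h • ∑ j, A i j • F j) =
      ∑ k ∈ Finset.range s, m k (b i • (k * (c i * h) ^ (k - 1)) • h • ∑ j, A i j • F j) :=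
    fun i => by
      generalize h • ∑ j, A i j • F j = x
      simp [polyFunDeriv, sum_apply, Finset.smul_sum]
  simp only [e1, e2]
  rw [Finset.sum_comm, Finset.sum_comm (γ := Fin s), ← Finset.sum_add_distrib, polyFun, sum_apply]
  refine Finset.sum_congr rfl fun k hk => ?_
  rw [← map_sum, ← map_sum, ← map_add, ← key k (Finset.mem_range.1 hk), map_smul]
  rfl

/-- Here F_i stands for f(Y_i), v for f(y) and J for f' along y. Multiplication by the approximate
adjoint M removes the first-order influence of the stage errors, so their order s+1 suffices for a
step error of order 2s+1. -/
lemma perturbed_order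
    (hs : 1 ≤ s)
    (hB : ∀ k < 2 * s, ∑ i, b i * c i ^ k = 1 / (k + 1))
    (hC : ∀ k < s, ∀ i, ∑ j, A i j * c j ^ k = c i ^ (k + 1) / (k + 1))
    (hD : ∀ k, k + 1 ≤ s → ∀ j,
      ∑ i, (k + 1) * b i * c i ^ k * A i j = b j * (1 - c j ^ (k + 1)))
    (hBr : ∀ k, k + 2 < s → ∀ i, ∑ j, B i j * c j ^ k = 0)
    (hBl : ∀ k, k + 2 < s → ∀ j, ∑ i, b i * c i ^ k * B i j = 0)
    (hBb : ∀ k l, k + l + 3 < 2 * s → ∑ i, ∑ j, b i * c i ^ k * B i j * c j ^ l = 0)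
    (hv : ContDiffAt ℝ (2 * s : ℕ) v 0) (hy : ∀ᶠ t in 𝓝 0, HasDerivAt y (v t) t)
    (hyc : ContDiffAt ℝ (2 * s : ℕ) y 0)
    {J : ℝ → E →L[ℝ] E} (hJ : ContDiffAt ℝ (2 * s - 1 : ℕ) J 0)
    (hβ : β =O[𝓝 0] fun h : ℝ => h ^ 3)
    (hY : ∀ᶠ h in 𝓝 0, ∀ i,
      Y i h = y 0 + h • ∑ j, A i j • F j h + β h • ∑ j, B i j • F j h)
    (hF : ∀ i, (fun h => F i h - v (c i * h)) =O[𝓝 0] fun h => Y i h - y (c i * h))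
    (hF2 : ∀ i, (fun h => F i h - v (c i * h) - J (c i * h) (Y i h - y (c i * h))) =O[𝓝 0]
      fun h => ‖Y i h - y (c i * h)‖ ^ 2) :
    (fun h => y 0 + h • ∑ i, b i • F i h - y h) =O[𝓝 0] fun h : ℝ => h ^ (2 * s + 1) := by
  have hZ := stage_error_isBigO hC hBr (hv.of_le (by exact_mod_cast (by omega : s ≤ 2 * s)))
    hy hβ hY hF
  have hDO : ∀ j, (fun h => F j h - v (c j * h)) =O[𝓝 0] fun h : ℝ => h ^ (s + 1) := fun j =>
    (hF j).trans (hZ j)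
  have hcv : ∀ {N : ℕ}, N ≤ 2 * s → ContDiffAt ℝ N v 0 := fun hN =>
    hv.of_le (by exact_mod_cast hN)
  have hBF : ∀ i, (fun h => β h • ∑ j, B i j • F j h) =O[𝓝 0] fun h : ℝ => h ^ (s + 1) := by
    intro i
    have h1 := nodal_functional_isBigO (w := B i) (c := c) (N := s - 2)
      (fun k hk => hBr k (by omega) i) (hcv (by omega))
    have h2 : (fun h => ∑ j, B i j • (F j h - v (c j * h))) =O[𝓝 0] fun h : ℝ => h ^ (s - 2) :=
      IsBigO.fun_sum fun j _ => ((hDO j).trans (pow_isBigO_pow (by omega))).const_smul_left _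
    refine IsBigO.congr_left (g := fun h : ℝ => h ^ (s + 1))
      ((hβ.smul (h1.add h2)).trans ?_) fun h => ?_
    · simp only [smul_eq_mul, ← pow_add]
      exact pow_isBigO_pow (by omega)
    · simp only [smul_sub, Finset.sum_sub_distrib]
      congr 1
      abel
  -- N = s-1 is the largest degree of M for which D(s) still gives summation by parts.
  obtain ⟨N, rfl⟩ : ∃ N, s = N + 1 := ⟨s - 1, by omega⟩
  obtain ⟨m, hm0, hm⟩ := exists_adjoint_polyFun (N := N)
    (hJ.of_le (by exact_mod_cast (by omega : N ≤ 2 * (N + 1) - 1)))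
  set M := polyFun m (N + 1) with hM
  set M' := polyFunDeriv m (N + 1) with hM'
  have hMc : ∀ {k : ℕ}, ContDiffAt ℝ k M 0 := (polyFun_contDiff m _).contDiffAt
  have hM'c : ∀ {k : ℕ}, ContDiffAt ℝ k M' 0 := (polyFunDeriv_contDiff m _).contDiffAt
  have hM1 : M 0 = 1 := by
    simp [hM, polyFun, Finset.sum_range_succ', hm0]
  have hMb : ∀ i, (fun h => M (c i * h)) =O[𝓝 0] fun _ : ℝ => (1 : ℝ) := fun i =>
    ((hMc (k := 0)).continuousAt.isBigO_one ℝ).comp_tendsto (tendsto_mul_left_zero (c i))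
  set e : Fin (N + 1) → ℝ → E := fun i h => h • ∑ j, A i j • F j h - (y (c i * h) - y 0) with he
  have heZ : ∀ᶠ h in 𝓝 0, ∀ i, Y i h - y (c i * h) = e i h + β h • ∑ j, B i j • F j h := by
    filter_upwards [hY] with h hh i
    rw [hh i]; simp only [he]; abel
  have heO : ∀ i, e i =O[𝓝 0] fun h : ℝ => h ^ (N + 1 + 1) := by
    intro i
    refine ((hZ i).sub (hBF i)).congr' ?_ EventuallyEq.rfl
    filter_upwards [heZ] with h hh
    rw [hh i, add_sub_cancel_right]
  have hid := isBigO_refl (fun h : ℝ => h) (𝓝 0)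
  -- T1 is the quadratic Taylor remainder, T2 the adjoint defect acting on e, T3 the direct effect
  -- of the perturbation, and T4 the Gauss quadrature error for (M(y - y 0))'.
  have T1 : (fun h => h • ∑ i, b i • M (c i * h)
      (F i h - v (c i * h) - J (c i * h) (Y i h - y (c i * h)))) =O[𝓝 0]
      fun h : ℝ => h ^ (2 * (N + 1) + 1) := by
    have : ∀ i, (fun h => M (c i * h)
        (F i h - v (c i * h) - J (c i * h) (Y i h - y (c i * h)))) =O[𝓝 0]
        fun h : ℝ => h ^ (2 * (N + 1)) := by
      intro i
      refine (isBigO_clm_apply (hMb i) ((hF2 i).trans ((hZ i).norm_left.pow 2))).trans ?_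
      simp only [one_mul, ← pow_mul]
      exact pow_isBigO_pow (by omega)
    refine (hid.smul (IsBigO.fun_sum fun i _ => (this i).const_smul_left (b i))).congr_right
      fun h => ?_
    rw [smul_eq_mul, ← pow_succ']
  have T2 : (fun h => h • ∑ i, b i • (M' (c i * h) + M (c i * h) * J (c i * h)) (e i h)) =O[𝓝 0]
      fun h : ℝ => h ^ (2 * (N + 1) + 1) := by
    have : ∀ i, (fun h => (M' (c i * h) + M (c i * h) * J (c i * h)) (e i h)) =O[𝓝 0]
        fun h : ℝ => h ^ (2 * (N + 1)) := by
      intro i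
      refine (isBigO_clm_apply (isBigO_comp_mul hm (c i)) (heO i)).congr_right fun h => ?_
      rw [← pow_add]; congr 1; ring
    refine (hid.smul (IsBigO.fun_sum fun i _ => (this i).const_smul_left (b i))).congr_right
      fun h => ?_
    rw [smul_eq_mul, ← pow_succ']
  have hMJ : ∀ {k : ℕ}, k ≤ 2 * (N + 1) - 1 → ContDiffAt ℝ k (fun t => M t * J t) 0 := fun hk =>
    hMc.mul (hJ.of_le (by exact_mod_cast hk))
  have T3 : (fun h => h • β h • ∑ i, ∑ j, (b i * B i j) •
      (M (c i * h) * J (c i * h)) (F j h)) =O[𝓝 0] fun h : ℝ => h ^ (2 * (N + 1) + 1) := by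
    have h1 := nodal_bilinear_isBigO (w := fun i j => b i * B i j) (c := c)
      (N := 2 * (N + 1) - 3) (K := fun t => M t * J t) (G := v) (fun k l hkl => by
        rw [← hBb k l (by omega)]
        exact Finset.sum_congr rfl fun i _ => Finset.sum_congr rfl fun j _ => by ring)
      (hMJ (by omega)) (hcv (by omega))
    -- Replacing F by v costs O(h^(s+1)), while left annihilation gives O(h^(s-2)); the product
    -- beats the required h^(2s-3).
    have h2 : (fun h => ∑ j, (∑ i, (b i * B i j) • (M (c i * h) * J (c i * h)))
        (F j h - v (c j * h))) =O[𝓝 0] fun h : ℝ => h ^ (2 * (N + 1) - 3) := by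
      refine IsBigO.fun_sum fun j _ => ?_
      have h3 := nodal_functional_isBigO (w := fun i => b i * B i j) (c := c) (N := N + 1 - 2)
        (G := fun t => M t * J t) (fun k hk => by
          rw [← hBl k (by omega) j]
          exact Finset.sum_congr rfl fun i _ => by ring) (hMJ (by omega))
      refine (isBigO_clm_apply h3 (hDO j)).trans ?_
      simp only [← pow_add]
      exact pow_isBigO_pow (by omega)
    refine IsBigO.congr_left (g := fun h : ℝ => h ^ (2 * (N + 1) + 1))
      ((hid.smul (hβ.smul (h1.add h2))).trans ?_) fun h => ?_
    · simp only [smul_eq_mul, ← pow_add, ← pow_succ']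
      exact pow_isBigO_pow (by omega)
    · congr 2
      rw [Finset.sum_comm, ← Finset.sum_add_distrib, Finset.sum_comm]
      refine Finset.sum_congr rfl fun j _ => ?_
      simp only [sum_apply, smul_apply, ← Finset.sum_add_distrib, ← smul_add, ← map_add,
        add_sub_cancel]
  have hg : ∀ᶠ t in 𝓝 0, HasDerivAt (fun t => M t (y t - y 0))
      (M' t (y t - y 0) + M t (v t)) t := by
    filter_upwards [hy] with t ht
    exact (polyFun_hasDerivAt m _ t).clm_apply (ht.sub_const (y 0))
  have T4 := quadrature_isBigO (w := b) (c := c) (x := 1) (N := 2 * (N + 1))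
    (fun k hk => by rw [hB k hk, one_pow]) hg
    ((hM'c.clm_apply (hyc.sub contDiffAt_const)).add (hMc.clm_apply hv))
  have hMe : (fun h => M h (y 0 + h • ∑ i, b i • F i h - y h)) =O[𝓝 0]
      fun h : ℝ => h ^ (2 * (N + 1) + 1) := by
    refine (((T1.add T2).add T3).add T4).congr' ?_ EventuallyEq.rfl
    filter_upwards [heZ] with h hh
    have hsum := polyFun_apply_weighted_sum hD m (fun i => F i h) h
    have hend : M h (y 0 + h • ∑ i, b i • F i h - y h) =
        h • (∑ i, b i • M (c i * h) (F i h) +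
          ∑ i, b i • M' (c i * h) (h • ∑ j, A i j • F j h)) - M h (y h - y 0) := by
      rw [← hsum, ← map_smul, ← map_sub]
      congr 1
      abel
    have hT3 : β h • ∑ i, ∑ j, (b i * B i j) • (M (c i * h) * J (c i * h)) (F j h) =
        ∑ i, b i • (M (c i * h) * J (c i * h)) (β h • ∑ j, B i j • F j h) := by
      simp only [map_smul, map_sum, Finset.smul_sum, smul_smul]
      exact Finset.sum_congr rfl fun i _ => Finset.sum_congr rfl fun j _ => by
        congr 1; ring
    rw [hend, hT3]
    simp only [one_mul, sub_self, map_zero, sub_zero]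
    rw [← add_sub_assoc, ← smul_add, ← smul_add, ← smul_add]
    simp only [← Finset.sum_add_distrib, ← smul_add]
    congr 2
    refine Finset.sum_congr rfl fun i _ => ?_
    congr 1
    -- The M J Z contribution splits along Z = e + β·BF: the e part joins M'e in T2, and the rest is
    -- T3.
    have h5 : h • ∑ j, A i j • F j h = e i h + (y (c i * h) - y 0) := by
      simp only [he]; abel
    have hmul : ∀ x, (M (c i * h) * J (c i * h)) x = M (c i * h) (J (c i * h) x) := fun _ => rfl
    rw [hh i, h5]
    simp only [map_add, map_sub, add_apply, hmul]
    abel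
  -- Since M(0) = 1, the error differs from M(h) times itself by a term of lower order, so M(h) is
  -- removed without inverting it.
  refine isBigO_of_add_isLittleO
    (q := fun h => (1 - M h) (y 0 + h • ∑ i, b i • F i h - y h)) ?_ hMe ?_
  · refine Eventually.of_forall fun h => ?_
    rw [← add_apply, add_sub_cancel]; rfl
  · have h1 : (fun h => 1 - M h) =o[𝓝 0] fun _ : ℝ => (1 : ℝ) := by
      rw [isLittleO_one_iff]
      have := (tendsto_const_nhds (x := (1 : E →L[ℝ] E))).sub (hMc (k := 0)).continuousAt.tendsto
      rwa [hM1, sub_self] at this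
    have h2 := h1.norm_left.mul_isBigO (isBigO_refl
      (fun h => ‖y 0 + h • ∑ i, b i • F i h - y h‖) (𝓝 0))
    simp only [one_mul] at h2
    refine IsBigO.trans_isLittleO (IsBigO.of_bound 1 (Eventually.of_forall fun h => ?_)) h2.of_norm_right
    rw [one_mul, Real.norm_of_nonneg (by positivity)]
    exact ContinuousLinearMap.le_opNorm _ _

end ErrorAnalysis

end QGauss

end

/-! ### Application to the perturbed Gauss method. -/

theorem theorem4p2 (s : ℕ) (hs : 1 ≤ s) (α : ℝ → ℝ)
    (hα : α =O[𝓝[≠] 0] fun h : ℝ => h ^ 2) :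
    QGauss.HasOrder (fun h => QGauss.butcher s (α h)) (QGauss.weight s) (2 * s) := by
  open QGauss in
  intro n U f y₀ t₀ y hU hf hy₀ hyt hy
  -- The value α(0) is unconstrained, but the factor h makes the bound hold at 0 as well.
  have hβ : (fun h => h * α h) =O[𝓝 0] fun h : ℝ => h ^ 3 := by
    obtain ⟨C, hC⟩ := hα.bound
    refine IsBigO.of_bound C ?_
    filter_upwards [eventually_nhdsWithin_iff.1 hC] with h hh
    by_cases h0 : h = 0
    · simp [h0]
    · have := hh h0
      rw [norm_mul, pow_succ', norm_mul]
      calc ‖h‖ * ‖α h‖ ≤ ‖h‖ * (C * ‖h ^ 2‖) := by gcongr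
        _ = C * (‖h‖ * ‖h ^ 2‖) := by ring
  have hfat : ContDiffAt ℝ (2 * s : ℕ) f y₀ := hf.contDiffAt (hU.mem_nhds hy₀)
  obtain ⟨r, hr, hrU, K, hK, hK2⟩ := exists_ball_estimates (hU.mem_nhds hy₀)
    (hfat.of_le (by exact_mod_cast (by omega : 2 ≤ 2 * s)))
  set z : ℝ → EuclideanSpace ℝ (Fin n) := fun t => y (t₀ + t) with hz
  have hz0 : z 0 = y₀ := by simp [hz, hyt]
  have htend : Tendsto (fun t => t₀ + t) (𝓝 0) (𝓝 t₀) := by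
    simpa using (continuous_const_add t₀).tendsto (0 : ℝ)
  have hzd : ∀ᶠ t in 𝓝 0, HasDerivAt z (f (z t)) t := by
    filter_upwards [htend.eventually hy] with t ht
    exact ht.comp_const_add t₀ t
  rw [← hz0] at hfat
  have hzc : ContDiffAt ℝ (2 * s : ℕ) z 0 := contDiffAt_of_ode hfat hzd
  have hvc : ContDiffAt ℝ (2 * s : ℕ) (fun t => f (z t)) 0 := hfat.comp (0 : ℝ) hzc
  have hJc : ContDiffAt ℝ (2 * s - 1 : ℕ) (fun t => fderiv ℝ f (z t)) 0 :=
    (hfat.fderiv_right (m := (2 * s - 1 : ℕ))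
      (by exact_mod_cast (by omega : 2 * s - 1 + 1 ≤ 2 * s))).comp (0 : ℝ)
      (hzc.of_le (by exact_mod_cast Nat.sub_le _ _))
  have hA : ∀ i j, Tendsto (fun h => h * butcher s (α h) i j) (𝓝 0) (𝓝 0) := by
    intro i j
    have h1 : Tendsto (fun h => h * α h) (𝓝 0) (𝓝 0) :=
      hβ.trans_tendsto (by simpa using (continuous_pow 3).tendsto (0 : ℝ))
    have h2 := (tendsto_id (x := 𝓝 (0 : ℝ))).mul_const (butcher s 0 i j)
    have h3 := h2.add (h1.mul_const (perturbation s i j))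
    simp only [zero_mul, add_zero] at h3
    refine h3.congr fun h => ?_
    rw [butcher_eq s (α h), Matrix.add_apply, Matrix.smul_apply, smul_eq_mul, id]
    ring
  have hex := existsUnique_stages hr hK hA
  have hch : ∀ h, ∃ Y : Fin s → EuclideanSpace ℝ (Fin n),
      (∃! Y : Fin s → EuclideanSpace ℝ (Fin n), (∀ i, Y i ∈ Metric.closedBall y₀ r) ∧
        IsStages (butcher s (α h)) f h y₀ Y) →
      (∀ i, Y i ∈ Metric.closedBall y₀ r) ∧ IsStages (butcher s (α h)) f h y₀ Y := by
    intro h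
    by_cases hh : ∃! Y : Fin s → EuclideanSpace ℝ (Fin n),
        (∀ i, Y i ∈ Metric.closedBall y₀ r) ∧ IsStages (butcher s (α h)) f h y₀ Y
    · exact ⟨hh.choose, fun _ => hh.choose_spec.1⟩
    · exact ⟨fun _ => y₀, fun h' => absurd h' hh⟩
  choose Y hYspec using hch
  have hYball : ∀ᶠ h in 𝓝 (0 : ℝ), ∀ i, Y h i ∈ Metric.closedBall y₀ r :=
    hex.mono fun h hh => (hYspec h hh).1
  have hzball : ∀ c : ℝ, ∀ᶠ h in 𝓝 (0 : ℝ), z (c * h) ∈ Metric.closedBall y₀ r := fun c =>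
    (hzc.continuousAt.tendsto.comp (tendsto_mul_left_zero c)).eventually
      (by rw [hz0]; exact Metric.closedBall_mem_nhds y₀ hr)
  have hmain := perturbed_order (A := butcher s 0) (B := perturbation s) (b := weight s)
    (c := node s) (y := z) (v := fun t => f (z t)) (β := fun h => h * α h)
    (Y := fun i h => Y h i) (F := fun i h => f (Y h i)) hs
    (fun k hk => gauss_weight_moment hk) (fun k hk i => gauss_stage_moment hk i)
    (fun k hk j => gauss_adjoint_moment hk j) (fun k hk i => perturbation_right hk i)
    (fun k hk j => perturbation_left hk j) (fun k l hkl => perturbation_bilinear hkl)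
    hvc hzd hzc hJc hβ
    (hex.mono fun h hh i => by
      have hst := (hYspec h hh).2 i
      rw [hz0]
      conv_lhs => rw [hst]
      simp only [butcher_eq s (α h), Matrix.add_apply, Matrix.smul_apply, smul_eq_mul, add_smul,
        Finset.sum_add_distrib, smul_add, Finset.smul_sum, smul_smul, add_assoc, mul_assoc])
    (fun i => IsBigO.of_bound K (by
      filter_upwards [hYball, hzball (node s i)] with h h1 h2
      exact hK.norm_sub_le (h1 i) h2))
    (fun i => IsBigO.of_bound K (by
      filter_upwards [hYball, hzball (node s i)] with h h1 h2
      rw [norm_pow, norm_norm]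
      exact hK2 _ (h1 i) _ h2))
  obtain ⟨C, hC⟩ := hmain.bound
  obtain ⟨ε, hε, hball⟩ := Metric.eventually_nhds_iff_ball.1 (hex.and hC)
  refine ⟨r, hr, hrU, ε / 2, half_pos hε, C, fun h hh => ?_⟩
  obtain ⟨h1, h2⟩ := hball h (by rw [mem_ball_zero_iff, Real.norm_eq_abs]; linarith)
  refine ⟨h1, fun Y' hY' hst => ?_⟩
  -- Uniqueness in the ball carries the bound from the chosen stages to any admissible ones.
  have heq : Y' = Y h := h1.unique ⟨hY', hst⟩ (hYspec h h1)
  rw [norm_pow, Real.norm_eq_abs, hz0] at h2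
  rw [heq]
  exact h2
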